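/- **Setting.** Let $G:\mathbb R^d\times\mathbb R^m\to\mathbb R$, let $y_1,y_2,\dots\in\mathbb R^m$ be fixed observations and let $x_0\in\mathbb R^d$. Let $(Q^l)_{l\ge 0}$ be Markov kernels on $\mathbb R^d$ and, for $l\ge1$, let $M^l$ be a Markov kernel on $\mathbb R^d\times\mathbb R^d$ such that $M^l((x,x'),\cdot)$ has first marginal $Q^l(x,\cdot)$ and second marginal $Q^{l-1}(x',\cdot)$. Put $$p^l(y_{1:n})=\int\prod_{k=1}^n G(x_k,y_k)\,Q^l(x_{k-1},dx_k).$$ *Algorithm.* Level $0$ is a particle filter with $N_0$ particles: $X_1^{0,i}\sim Q^0(x_0,\cdot)$ i.i.d.; then, given the time-$k$ particles, each new particle independently picks an ancestor with probabilities proportional to $G(X_k^{0,j},y_k)$ and is moved with $Q^0$. Level $l\in\{1,\dots,L\}$ is a coupled particle filter with $N_l$ pairs: $(X_{1,1}^{l,i},X_{1,2}^{l,i})\sim M^l((x_0,x_0),\cdot)$ i.i.d.; given the time-$k$ pairs, let $w_{1}^j,w_{2}^j$ be the normalised weights of the first and second components (proportional to $G(X^{l,j}_{k,1},y_k)$, $G(X^{l,j}_{k,2},y_k)$)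 and $\alpha=\sum_j w_1^j\wedge w_2^j$; each new pair independently draws ancestor indices $(I_1,I_2)$, with probability $\alpha$ as $I_1=I_2$ drawn from $(w_1\wedge w_2)/\alpha$, and otherwise independently from the normalised residuals $w_1-w_1\wedge w_2$ and $w_2-w_1\wedge w_2$, and is then drawn from $M^l((X^{l,I_1}_{k,1},X^{l,I_2}_{k,2}),\cdot)$. The $L+1$ filters are independent. The multilevel estimator is $$\widehat p^{L,N_{0:L}}(y_{1:n})=\prod_{k=1}^n\frac1{N_0}\sum_{i}G(X_k^{0,i},y_k)+\sum_{l=1}^L\Big\{\prod_{k=1}^n\frac1{N_l}\sum_iG(X_{k,1}^{l,i},y_k)-\prod_{k=1}^n\frac1{N_l}\sum_iG(X_{k,2}^{l,i},y_k)\Big\}.$$ *Assumption (A).* (A1) There are $c>1$, $C>0$ with $c^{-1}<G(x,y_k)<c$ and $|G(x,y_k)-G(x',y_k)|\le C|x-x'|$ for all $k\ge1$, $x,x'$. (A2) There is $C>0$ such that $|Q^l\varphi(u)-Q^l\varphi(u')|\le C\,\|\varphi\|_\infty|u-u'|$ for all $l\ge 0$, all $u,u'$ and all bounded Lipschitz $\varphi$.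 **Theorem.** (1) Assume (A). Then there are finite constants $B_l(n)$ such that for all $n,L\ge1$ and all $N_0,\dots,N_L\ge1$ the estimator is square integrable, is unbiased for $p^L(y_{1:n})$, and $$\mathbb E\big[(\widehat p^{L,N_{0:L}}(y_{1:n})-p^L(y_{1:n}))^2\big]\le\sum_{l=0}^L\frac{B_l(n)}{N_l}.$$ (2) (Euler case.) Let $a:\mathbb R^d\to\mathbb R^d$, $b:\mathbb R^d\to\mathbb R^{d\times d}$ be $C^2$ and globally Lipschitz, with $bb^T$ uniformly positive definite. Let $h_l=2^{-l}$, let $Q^l$ be the law at time $1$ of the Euler scheme for $dX_t=a(X_t)dt+b(X_t)dW_t$ with step $h_l$, and let $M^l$ be the joint law of the schemes with steps $h_l$ and $h_{l-1}$ driven by the same Gaussian increments (each coarse increment being the sum of two fine ones); this is a coupling as above. If (A) holds, then the bound in (1) holds for all $n,L,N_0,\dots,N_L\ge1$ with constants satisfying $B_l(n)\le C(n)h_l^{1/2}$ for all $l$, where $C(n)$ does not depend on $l$, $L$, $N_{0:L}$ or $\varepsilon$. Moreover, for $\varepsilon\in(0,1)$ put $L=\lceil\log_2(1/\varepsilon)\rceil$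 and $N_l=\lceil\varepsilon^{-2}h_l^{3/4}\sum_{k=0}^Lh_k^{-1/4}\rceil$. Then the cost at a given time, $\sum_{l=0}^LN_lh_l^{-1}$, is at most $C(n)\varepsilon^{-2.5}$ and $$\mathbb E\big[(\widehat p^{L,N_{0:L}}(y_{1:n})-p^L(y_{1:n}))^2\big]\le C(n)\varepsilon^2,$$ and for all real $p$, $K$ with $|p^L(y_{1:n})-p|\le Kh_L$ (a target that $p^L$ approximates with bias of order $h_L$, such as the normalizing constant of the exact diffusion when the Euler scheme has weak order one), $$\mathbb E\big[(\widehat p^{L,N_{0:L}}(y_{1:n})-p)^2\big]\le (C(n)+K^2)\,\varepsilon^2.$$ -/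

import Mathlib

open MeasureTheory ProbabilityTheory

namespace MLPF

noncomputable section

/-! ### Markov chains and independent copies -/

/-- The kernel that, given `a`, draws `N` independent samples from `κ a`. -/
def iidKernel {α β : Type*} [MeasurableSpace α] [MeasurableSpace β] (N : ℕ)
    (κ : Kernel α β) [IsMarkovKernel κ] : Kernel α (Fin N → β) where
  toFun a := Measure.pi fun _ : Fin N => κ a
  measurable' := by
    refine Measurable.measure_of_isPiSystem_of_isProbabilityMeasure
      generateFrom_pi.symm isPiSystem_pi ?_
    rintro _ ⟨s, hs, rfl⟩
    simp only [Measure.pi_pi]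
    exact Finset.measurable_prod _ fun i _ => κ.measurable_coe (hs i (Set.mem_univ i))

instance {α β : Type*} [MeasurableSpace α] [MeasurableSpace β] (N : ℕ)
    (κ : Kernel α β) [IsMarkovKernel κ] : IsMarkovKernel (iidKernel N κ) :=
  ⟨fun a => by
    change IsProbabilityMeasure (Measure.pi fun _ : Fin N => κ a)
    infer_instance⟩

/-- The law on trajectories of the Markov chain with initial law `μ₀` and with transition kernel
`K k` from time `k` to time `k + 1`. -/
def chainLaw {S : Type*} [MeasurableSpace S] (μ₀ : Measure S) (K : ℕ → Kernel S S)
    [∀ k, IsMarkovKernel (K k)] : Measure (ℕ → S) :=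
  Kernel.trajMeasure (X := fun _ => S) μ₀ fun k =>
    (K k).comap (fun p => p ⟨k, Finset.mem_Iic.2 le_rfl⟩) (by fun_prop)

/-! ### Potentials, and the marginal likelihood -/

/-- A measurable, strictly positive function, the likelihood `x ↦ G(x, y)` of an observation. -/
structure Potential (E : Type*) [MeasurableSpace E] where
  /-- the underlying function -/
  toFun : E → ℝ
  measurable : Measurable toFun
  pos : ∀ x, 0 < toFun x

instance {E : Type*} [MeasurableSpace E] : CoeFun (Potential E) fun _ => E → ℝ :=
  ⟨Potential.toFun⟩

/-- `∫ ∏_{i = 1}^n g_{i-1}(x_i) Q(x_{i-1}, dx_i)` for the chain started at `x₀ = x`, as an iterated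
integral: the marginal likelihood `p(y_{1:n})` when `g_{i-1} = G(·, y_i)`. -/
def marginalLikelihood {E : Type*} [MeasurableSpace E] (Q : Kernel E E) :
    ℕ → (ℕ → Potential E) → E → ℝ
  | 0, _, _ => 1
  | n + 1, g, x => ∫ x', g 0 x' * marginalLikelihood Q n (fun k => g (k + 1)) x' ∂(Q x)

/-! ### Particle filter and coupled particle filter -/

section Filters

variable {E : Type*} [MeasurableSpace E] {N : ℕ}

/-- Normalised weight of particle `i`. -/
def weight (g : Potential E) (x : Fin N → E) (i : Fin N) : ℝ :=
  g (x i) / ∑ j, g (x j)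

lemma measurable_weight (g : Potential E) (i : Fin N) :
    Measurable fun x : Fin N → E => weight g x i := by
  unfold weight
  have := g.measurable
  fun_prop

lemma weight_nonneg (g : Potential E) (x : Fin N → E) (i : Fin N) : 0 ≤ weight g x i :=
  div_nonneg (g.pos _).le (Finset.sum_nonneg fun _ _ => (g.pos _).le)

lemma sum_weight (g : Potential E) (x : Fin N → E) (hN : 0 < N) : ∑ i, weight g x i = 1 := by
  have : Nonempty (Fin N) := ⟨⟨0, hN⟩⟩
  unfold weight
  rw [← Finset.sum_div]
  exact div_self (Finset.sum_pos (fun _ _ => g.pos _) Finset.univ_nonempty).ne'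

/-- Joint law of the pair of ancestor indices under coupled resampling with weight vectors
`w₁, w₂`. With `m = w₁ ∧ w₂` and `α = ∑ m`: with probability `α` both indices are equal and drawn
from `m / α`; with probability `1 - α` they are drawn independently from the normalised residuals
`w₁ - m` and `w₂ - m`. -/
def coupledResampling (w₁ w₂ : Fin N → ℝ) (i j : Fin N) : ℝ :=
  let m : Fin N → ℝ := fun s => min (w₁ s) (w₂ s)
  let α : ℝ := ∑ s, m s
  α * (if i = j then m i / α else 0) +
    (1 - α) * (((w₁ i - m i) / ∑ s, (w₁ s - m s)) * ((w₂ j - m j) / ∑ s, (w₂ s - m s)))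

lemma coupledResampling_nonneg {w₁ w₂ : Fin N → ℝ} (h₁ : ∀ i, 0 ≤ w₁ i) (h₂ : ∀ i, 0 ≤ w₂ i)
    (s₁ : ∑ i, w₁ i = 1) (i j : Fin N) : 0 ≤ coupledResampling w₁ w₂ i j := by
  have hm : ∀ s, 0 ≤ min (w₁ s) (w₂ s) := fun s => le_min (h₁ s) (h₂ s)
  have hα : 0 ≤ ∑ s, min (w₁ s) (w₂ s) := Finset.sum_nonneg fun s _ => hm s
  have hα1 : ∑ s, min (w₁ s) (w₂ s) ≤ 1 :=
    s₁ ▸ Finset.sum_le_sum fun s _ => min_le_left _ _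
  have e₁ : ∀ s, 0 ≤ w₁ s - min (w₁ s) (w₂ s) := fun s => sub_nonneg.2 (min_le_left _ _)
  have e₂ : ∀ s, 0 ≤ w₂ s - min (w₁ s) (w₂ s) := fun s => sub_nonneg.2 (min_le_right _ _)
  unfold coupledResampling
  refine add_nonneg (mul_nonneg hα ?_) (mul_nonneg (sub_nonneg.2 hα1) (mul_nonneg ?_ ?_))
  · split_ifs
    · exact div_nonneg (hm i) hα
    · exact le_rfl
  · exact div_nonneg (e₁ i) (Finset.sum_nonneg fun s _ => e₁ s)
  · exact div_nonneg (e₂ j) (Finset.sum_nonneg fun s _ => e₂ s)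

lemma sum_coupledResampling {w₁ w₂ : Fin N → ℝ} (h₁ : ∀ i, 0 ≤ w₁ i) (h₂ : ∀ i, 0 ≤ w₂ i)
    (s₁ : ∑ i, w₁ i = 1) (s₂ : ∑ i, w₂ i = 1) :
    ∑ i, ∑ j, coupledResampling w₁ w₂ i j = 1 := by
  have hm : ∀ s, 0 ≤ min (w₁ s) (w₂ s) := fun s => le_min (h₁ s) (h₂ s)
  simp only [coupledResampling, Finset.sum_add_distrib, ← Finset.mul_sum, Finset.sum_ite_eq,
    Finset.mem_univ, if_true, ← Finset.sum_mul, ← Finset.sum_div, Finset.sum_sub_distrib, s₁, s₂]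
  set α := ∑ s, min (w₁ s) (w₂ s) with hα
  have e : α * (α / α) = α := by
    rcases eq_or_ne α 0 with h | h
    · simp [h]
    · rw [div_self h, mul_one]
  rw [e]
  rcases eq_or_ne (1 - α) 0 with h | h
  · rw [h]; linarith
  · rw [div_self h]; ring

lemma measurable_coupledResampling {α : Type*} [MeasurableSpace α] {w₁ w₂ : α → Fin N → ℝ}
    (h₁ : ∀ i, Measurable fun a => w₁ a i) (h₂ : ∀ i, Measurable fun a => w₂ a i) (i j : Fin N) :
    Measurable fun a => coupledResampling (w₁ a) (w₂ a) i j := by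
  unfold coupledResampling
  split_ifs <;> fun_prop

/-- One particle of the next generation of the particle filter: an ancestor is drawn from the
weights and then moved with `Q`. -/
def selectMove (g : Potential E) (Q : Kernel E E) (N : ℕ) : Kernel (Fin N → E) E where
  toFun x := ∑ i, ENNReal.ofReal (weight g x i) • Q (x i)
  measurable' := by
    refine Measure.measurable_of_measurable_coe _ fun s hs => ?_
    simp only [Measure.coe_finsetSum, Finset.sum_apply, Measure.smul_apply, smul_eq_mul]
    exact Finset.measurable_sum _ fun i _ => (measurable_weight g i).ennreal_ofReal.mul
      ((Q.measurable_coe hs).comp (measurable_pi_apply i))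

/-- One pair of the next generation of the coupled particle filter: a pair of ancestor indices is
drawn by coupled resampling, and the two selected (first, second) components are moved with `M`. -/
def coupledSelectMove (g : Potential E) (M : Kernel (E × E) (E × E)) (N : ℕ) :
    Kernel (Fin N → E × E) (E × E) where
  toFun v := ∑ i, ∑ j,
    ENNReal.ofReal (coupledResampling (weight g fun s => (v s).1) (weight g fun s => (v s).2) i j) •
      M ((v i).1, (v j).2)
  measurable' := by
    refine Measure.measurable_of_measurable_coe _ fun s hs => ?_
    simp only [Measure.coe_finsetSum, Finset.sum_apply, Measure.smul_apply, smul_eq_mul]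
    refine Finset.measurable_sum _ fun i _ => Finset.measurable_sum _ fun j _ =>
      Measurable.mul (Measurable.ennreal_ofReal ?_) ((M.measurable_coe hs).comp (by fun_prop))
    have h₁ : Measurable fun (v : Fin N → E × E) (s : Fin N) => (v s).1 := by fun_prop
    have h₂ : Measurable fun (v : Fin N → E × E) (s : Fin N) => (v s).2 := by fun_prop
    exact measurable_coupledResampling
      (w₁ := fun v : Fin N → E × E => weight g fun s => (v s).1)
      (w₂ := fun v : Fin N → E × E => weight g fun s => (v s).2)
      (fun i => (measurable_weight g i).comp h₁) (fun i => (measurable_weight g i).comp h₂) i j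

instance (g : Potential E) (Q : Kernel E E) [IsMarkovKernel Q] (N : ℕ) [NeZero N] :
    IsMarkovKernel (selectMove g Q N) :=
  ⟨fun x => ⟨by
    change (∑ i, ENNReal.ofReal (weight g x i) • Q (x i)) Set.univ = 1
    simp only [Measure.coe_finsetSum, Finset.sum_apply, Measure.smul_apply, smul_eq_mul,
      measure_univ, mul_one]
    rw [← ENNReal.ofReal_sum_of_nonneg fun i _ => weight_nonneg g x i,
      sum_weight g x (NeZero.pos N), ENNReal.ofReal_one]⟩⟩

instance (g : Potential E) (M : Kernel (E × E) (E × E)) [IsMarkovKernel M] (N : ℕ) [NeZero N] :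
    IsMarkovKernel (coupledSelectMove g M N) :=
  ⟨fun v => ⟨by
    change (∑ i, ∑ j, ENNReal.ofReal (coupledResampling (weight g fun s => (v s).1)
      (weight g fun s => (v s).2) i j) • M ((v i).1, (v j).2)) Set.univ = 1
    simp only [Measure.coe_finsetSum, Finset.sum_apply, Measure.smul_apply, smul_eq_mul,
      measure_univ, mul_one]
    have h : ∀ i j : Fin N, 0 ≤ coupledResampling (weight g fun s => (v s).1)
        (weight g fun s => (v s).2) i j := fun i j =>
      coupledResampling_nonneg (weight_nonneg g _) (weight_nonneg g _)
        (sum_weight g _ (NeZero.pos N)) i j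
    simp_rw [← ENNReal.ofReal_sum_of_nonneg fun j _ => h _ j]
    rw [← ENNReal.ofReal_sum_of_nonneg fun i _ => Finset.sum_nonneg fun j _ => h i j,
      sum_coupledResampling (weight_nonneg g _) (weight_nonneg g _)
        (sum_weight g _ (NeZero.pos N)) (sum_weight g _ (NeZero.pos N)), ENNReal.ofReal_one]⟩⟩

/-- Law of the particle filter with `N` particles started at `x₀`: `N` independent draws from
`Q(x₀, ·)`, then repeated selection (with weights from `g k` at index `k`) and mutation.
Index `k` of the trajectory is observation time `k + 1`. -/
def filterLaw (g : ℕ → Potential E) (Q : Kernel E E) [IsMarkovKernel Q] (x₀ : E)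
    (N : ℕ) [NeZero N] : Measure (ℕ → Fin N → E) :=
  chainLaw (Measure.pi fun _ : Fin N => Q x₀) fun k => iidKernel N (selectMove (g k) Q N)

/-- Law of the coupled particle filter with `N` pairs started at `(x₀, x₀)`. -/
def coupledFilterLaw (g : ℕ → Potential E) (M : Kernel (E × E) (E × E)) [IsMarkovKernel M]
    (x₀ : E) (N : ℕ) [NeZero N] : Measure (ℕ → Fin N → E × E) :=
  chainLaw (Measure.pi fun _ : Fin N => M (x₀, x₀)) fun k =>
    iidKernel N (coupledSelectMove (g k) M N)

/-- The estimate `∏_{k = 1}^n (1 / N) ∑_i G(x_k^i, y_k)` of the marginal likelihood. -/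
def likelihoodEstimate (g : ℕ → Potential E) (n : ℕ) (x : ℕ → Fin N → E) : ℝ :=
  ∏ k ∈ Finset.range n, (1 / (N : ℝ)) * ∑ i, g k (x k i)

end Filters

/-! ### The multilevel particle filter -/

section Multilevel

variable {E : Type*} [MeasurableSpace E]

/-- Outcomes of the multilevel particle filter: a particle trajectory at level `0`, and for
`l < L` a trajectory of pairs (fine, coarse) at level `l + 1`. -/
abbrev Outcome (E : Type*) (L : ℕ) (N : ℕ → ℕ+) : Type _ :=
  (ℕ → Fin (N 0) → E) × ((l : Fin L) → ℕ → Fin (N (l + 1)) → E × E)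

/-- Law of the multilevel particle filter: independently, a particle filter for `Q 0` and, for
`1 ≤ l ≤ L`, a coupled particle filter for `M l`. (`M 0` is not used.) -/
def multilevelLaw (g : ℕ → Potential E) (Q : ℕ → Kernel E E) [∀ l, IsMarkovKernel (Q l)]
    (M : ℕ → Kernel (E × E) (E × E)) [∀ l, IsMarkovKernel (M l)] (x₀ : E)
    (L : ℕ) (N : ℕ → ℕ+) : Measure (Outcome E L N) :=
  (filterLaw g (Q 0) x₀ (N 0)).prod
    (Measure.pi fun l : Fin L => coupledFilterLaw g (M (l + 1)) x₀ (N (l + 1)))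

/-- The multilevel estimator of the marginal likelihood at level `L`. -/
def multilevelEstimate (g : ℕ → Potential E) (n L : ℕ) (N : ℕ → ℕ+) (ω : Outcome E L N) : ℝ :=
  likelihoodEstimate g n ω.1 +
    ∑ l : Fin L, (likelihoodEstimate g n (fun k i => (ω.2 l k i).1) -
      likelihoodEstimate g n (fun k i => (ω.2 l k i).2))

/-- For every `l ≥ 1`, `M l` is a coupling of `Q l` (fine) and `Q (l - 1)` (coarse). -/
def IsMultilevelCoupling (Q : ℕ → Kernel E E) (M : ℕ → Kernel (E × E) (E × E)) : Prop :=
  ∀ (l : ℕ) (x x' : E),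
    (M (l + 1) (x, x')).map Prod.fst = Q (l + 1) x ∧ (M (l + 1) (x, x')).map Prod.snd = Q l x'

end Multilevel

/-! ### Assumptions -/

/-- The potentials are bounded above, bounded away from zero, and Lipschitz, uniformly in time. -/
def PotentialAssumption {E : Type*} [PseudoMetricSpace E] (g : ℕ → E → ℝ) : Prop :=
  ∃ c : ℝ, 1 < c ∧ ∃ C : ℝ, 0 < C ∧ ∀ (k : ℕ),
    (∀ x, c⁻¹ < g k x ∧ g k x < c) ∧ ∀ x x', |g k x - g k x'| ≤ C * dist x x'

/-- The functions of `PotentialAssumption` as potentials. -/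
def PotentialAssumption.potential {E : Type*} [PseudoMetricSpace E] [MeasurableSpace E]
    [OpensMeasurableSpace E] {g : ℕ → E → ℝ} (h : PotentialAssumption g) (k : ℕ) :
    Potential E where
  toFun := g k
  measurable := by
    obtain ⟨_, _, C, _, hg⟩ := h
    exact (LipschitzWith.of_dist_le' (K := C) fun x x' => (hg k).2 x x').continuous.measurable
  pos x := by
    obtain ⟨c, hc, _, _, hg⟩ := h
    exact (inv_pos.2 (zero_lt_one.trans hc)).trans ((hg k).1 x).1

/-- `|Q_l φ(u) - Q_l φ(u')| ≤ C ‖φ‖ |u - u'|` for all bounded Lipschitz `φ`, with `‖φ‖` the supremum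
norm and `C` uniform over the levels. -/
def KernelAssumption {E : Type*} [PseudoMetricSpace E] [MeasurableSpace E]
    (Q : ℕ → Kernel E E) : Prop :=
  ∃ C : ℝ, 0 < C ∧ ∀ (l : ℕ) (φ : E → ℝ) (s : ℝ), (∃ K, LipschitzWith K φ) → (∀ x, |φ x| ≤ s) →
    ∀ u u', |∫ x, φ x ∂(Q l u) - ∫ x, φ x ∂(Q l u')| ≤ C * s * dist u u'

/-! ### Euler discretisation of a diffusion -/

section Euler

variable {d : ℕ}

/-- `ℝ^d` with the Euclidean norm. -/
local notation "𝔼" => EuclideanSpace ℝ (Fin d)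

/-- Standing assumptions on the diffusion `dX = a(X) dt + b(X) dW`: `C²` coefficients, uniform
ellipticity and a global Lipschitz condition. -/
structure DiffusionAssumption (a : C(𝔼, 𝔼)) (b : C(𝔼, 𝔼 →L[ℝ] 𝔼)) : Prop where
  contDiff_drift : ContDiff ℝ 2 a
  contDiff_diffusion : ContDiff ℝ 2 b
  elliptic : ∃ c : ℝ, 0 < c ∧ ∀ x v : 𝔼,
    c * ‖v‖ ^ 2 ≤ inner ℝ v (b x (ContinuousLinearMap.adjoint (b x) v))
  lipschitz : ∃ C : ℝ, 0 < C ∧ ∀ x x' : 𝔼, ‖a x - a x'‖ + ‖b x - b x'‖ ≤ C * ‖x - x'‖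

/-- The step size `h_l = 2^{-l}`. -/
def stepSize (l : ℕ) : ℝ := (2 ^ l)⁻¹

/-- `x + h a(x) + b(x) w`, one Euler step of size `h` with Brownian increment `w`. -/
def eulerMap (a : C(𝔼, 𝔼)) (b : C(𝔼, 𝔼 →L[ℝ] 𝔼)) (h : ℝ) (x w : 𝔼) : 𝔼 :=
  x + h • a x + b x w

lemma continuous_eulerMap (a : C(𝔼, 𝔼)) (b : C(𝔼, 𝔼 →L[ℝ] 𝔼)) (h : ℝ) :
    Continuous fun p : 𝔼 × 𝔼 => eulerMap a b h p.1 p.2 := by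
  unfold eulerMap
  fun_prop

/-- One Euler step of size `h`, with increment `√h ξ`, where `ξ` is standard Gaussian. -/
def eulerStep (a : C(𝔼, 𝔼)) (b : C(𝔼, 𝔼 →L[ℝ] 𝔼)) (h : ℝ) : Kernel 𝔼 𝔼 :=
  (Kernel.id ×ₖ Kernel.const 𝔼 (stdGaussian 𝔼)).map
    fun p : 𝔼 × 𝔼 => eulerMap a b h p.1 (√h • p.2)

instance (a : C(𝔼, 𝔼)) (b : C(𝔼, 𝔼 →L[ℝ] 𝔼)) (h : ℝ) : IsMarkovKernel (eulerStep a b h) :=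
  Kernel.IsMarkovKernel.map _ ((continuous_eulerMap a b h).comp
    (f := fun p : 𝔼 × 𝔼 => (p.1, √h • p.2)) (by fun_prop)).measurable

/-- Two Euler steps of size `h` for the fine component, and one of size `2 h` for the coarse
component, driven by the same Gaussian variables `ξ₀, ξ₁`: the coarse increment is
`√h (ξ₀ + ξ₁)`, the sum of the two fine ones. -/
def coupledEulerStep (a : C(𝔼, 𝔼)) (b : C(𝔼, 𝔼 →L[ℝ] 𝔼)) (h : ℝ) : Kernel (𝔼 × 𝔼) (𝔼 × 𝔼) :=
  (Kernel.id ×ₖ Kernel.const (𝔼 × 𝔼) ((stdGaussian 𝔼).prod (stdGaussian 𝔼))).map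
    fun p : (𝔼 × 𝔼) × (𝔼 × 𝔼) =>
      (eulerMap a b h (eulerMap a b h p.1.1 (√h • p.2.1)) (√h • p.2.2),
        eulerMap a b (2 * h) p.1.2 (√h • (p.2.1 + p.2.2)))

instance (a : C(𝔼, 𝔼)) (b : C(𝔼, 𝔼 →L[ℝ] 𝔼)) (h : ℝ) :
    IsMarkovKernel (coupledEulerStep a b h) := by
  refine Kernel.IsMarkovKernel.map _ (Continuous.measurable ?_)
  unfold eulerMap
  fun_prop

instance instMarkovPow {S : Type*} [MeasurableSpace S] (K : Kernel S S) [IsMarkovKernel K]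
    (n : ℕ) : IsMarkovKernel (K ^ n) := by
  induction n with
  | zero => exact (inferInstance : IsMarkovKernel (Kernel.id : Kernel S S))
  | succ n ih =>
    rw [pow_succ]
    exact (inferInstance : IsMarkovKernel ((K ^ n) ∘ₖ K))

/-- The Euler approximation at level `l` of the transition over one unit of time: `2^l` steps of
size `h_l`. -/
def eulerKernel (a : C(𝔼, 𝔼)) (b : C(𝔼, 𝔼 →L[ℝ] 𝔼)) (l : ℕ) : Kernel 𝔼 𝔼 :=
  eulerStep a b (stepSize l) ^ (2 ^ l)

instance (a : C(𝔼, 𝔼)) (b : C(𝔼, 𝔼 →L[ℝ] 𝔼)) (l : ℕ) : IsMarkovKernel (eulerKernel a b l) :=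
  instMarkovPow _ _

/-- The coupled Euler kernel at level `l ≥ 1`: over one unit of time, `2^l` fine steps of size `h_l`
and `2^(l-1)` coarse steps of size `h_{l-1} = 2 h_l`. (The value at `l = 0` is not used.) -/
def coupledEulerKernel (a : C(𝔼, 𝔼)) (b : C(𝔼, 𝔼 →L[ℝ] 𝔼)) (l : ℕ) :
    Kernel (𝔼 × 𝔼) (𝔼 × 𝔼) :=
  coupledEulerStep a b (stepSize l) ^ (2 ^ (l - 1))

instance (a : C(𝔼, 𝔼)) (b : C(𝔼, 𝔼 →L[ℝ] 𝔼)) (l : ℕ) :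
    IsMarkovKernel (coupledEulerKernel a b l) :=
  instMarkovPow _ _

end Euler

/-! ### Cost and allocation of the sample sizes -/

/-- Cost of the multilevel particle filter at a given time: each of the `N_l` samples at level `l`
takes `h_l⁻¹` Euler steps. -/
def multilevelCost (L : ℕ) (N : ℕ → ℕ+) : ℝ :=
  ∑ l ∈ Finset.range (L + 1), (N l : ℝ) * (stepSize l)⁻¹

/-- The finest level `L = ⌈log₂(1/ε)⌉`. -/
def finestLevel (ε : ℝ) : ℕ := ⌈Real.logb 2 ε⁻¹⌉₊

/-- The allocation `N_l = ⌈ε^{-2} h_l^{3/4} K_L⌉` with `K_L = ∑_{k ≤ L} h_k^{-1/4}` and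
`L = finestLevel ε`. -/
def sampleSizes (ε : ℝ) (l : ℕ) : ℕ+ :=
  ⟨max 1 ⌈ε ^ (-2 : ℝ) * stepSize l ^ (3 / 4 : ℝ) *
    ∑ k ∈ Finset.range (finestLevel ε + 1), stepSize k ^ (-(1 / 4) : ℝ)⌉₊,
    lt_of_lt_of_le one_pos (le_max_left _ _)⟩

end

end MLPF

open MLPF

/-! Each filter carries a martingale. With observations indexed `0, …, n`, let `V_k(x)` be `g_k(x)`
times the likelihood of the observations after `k` for a chain at `x` (`backwardLikelihood`). The
product of the first `k` averages of potentials, times the average of `V_k` over the particles at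
index `k`, is a martingale in `k`: resampling weights have the average of `g_k` as denominator up to
a factor `N`, and this cancels against the next factor of the product. It starts with mean the
marginal likelihood and ends at the estimate, which gives unbiasedness. Particles are conditionally
i.i.d., so each step adds at most `1 / N` times an average of squares
(`average_martingale_mean_sq`).

For a coupled filter the difference of the two martingales is again one, because coupled resampling
and `M` have the right marginals. Its squared increments are small when the components of the pairs
are close. Closeness is measured by a function `Ψ` with values in `[0, 1]` that dominates the
oscillation of the potentials and grows at most by a factor `A` under `M` (`IsCouplingControl`). In
a selection step a pair with a common ancestor keeps its `Ψ` up to constants, while a pair with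
separate ancestors has only `Ψ ≤ 1`, an event of probability at most a constant times the average of
`Ψ`. Hence the mean of `Ψ` grows by a constant factor per step (`integral_coupledSelectMove_le`),
and the mean square error is at most a constant times `Ψ(x₀, x₀) / N` (`coupledFilterLaw_sq_le`).
Separation is a first-order event, which is why `Ψ` behaves like a distance and not like a squared
distance.

Levels are independent and their means telescope, so the variances add (`multilevelLaw_mean_sq`).
Part (1) is the choice `Ψ = 1`. For Euler schemes, `|x - x'|² + h (1 + |x|²)` grows by a factor `1 +
O(h)` per coupled step, the second term absorbing the local error of order `h²`. Over unit time this
is a bounded factor, and the truncated square root is a valid `Ψ`, of order `h^{1/2}` on the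
diagonal. The rest is the arithmetic of the allocation and the split of the error into variance and
squared bias. -/

namespace MLPF

/-! ### One-step identities for the law of a Markov chain -/

section Chain

variable {S : Type*} [MeasurableSpace S] {μ₀ : Measure S}
  {K : ℕ → Kernel S S} [∀ k, IsMarkovKernel (K k)]

instance isProbabilityMeasure_chainLaw [IsProbabilityMeasure μ₀] : IsProbabilityMeasure (chainLaw μ₀ K) := by
  unfold chainLaw
  infer_instance

lemma chainLaw_map_zero : (chainLaw μ₀ K).map (fun ω => ω 0) = μ₀ := by
  have h : (fun ω : ℕ → S => ω 0) =
      (fun p : (i : Finset.Iic 0) → S => p ⟨0, Finset.mem_Iic.2 le_rfl⟩) ∘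
        Preorder.frestrictLe (π := fun _ => S) 0 := rfl
  rw [h, ← Measure.map_map (by fun_prop) (by fun_prop), chainLaw, Kernel.trajMeasure,
    Measure.map_comp _ _ (by fun_prop), Kernel.traj_map_frestrictLe, Kernel.partialTraj_self,
    Measure.id_comp, Measure.map_map (by fun_prop) (by fun_prop)]
  exact Measure.map_id

lemma integral_chainLaw_zero {F : S → ℝ} (hF : Measurable F) :
    ∫ ω, F (ω 0) ∂(chainLaw μ₀ K) = ∫ s, F s ∂μ₀ := by
  conv_rhs => rw [← chainLaw_map_zero (μ₀ := μ₀) (K := K)]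
  rw [integral_map (measurable_pi_apply 0).aemeasurable hF.aestronglyMeasurable]

/-- Markov property for test functions that may look at the whole past. By `hdep` such a function
factors through the history up to `k`, and the joint law of that history and the next state is a
`⊗ₘ` product. -/
lemma integral_chainLaw_succ [IsProbabilityMeasure μ₀] (k : ℕ) {F : (ℕ → S) → S → ℝ}
    (hF : Measurable (Function.uncurry F)) {C : ℝ} (hC : ∀ ω s, |F ω s| ≤ C)
    (hdep : ∀ ω ω' s, (∀ j ≤ k, ω j = ω' j) → F ω s = F ω' s) :
    ∫ ω, F ω (ω (k + 1)) ∂(chainLaw μ₀ K) = ∫ ω, ∫ s, F ω s ∂(K k (ω k)) ∂(chainLaw μ₀ K) := by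
  obtain ⟨s₀⟩ : Nonempty S := nonempty_of_isProbabilityMeasure μ₀
  -- Pads a finite history to a full path; the filler `s₀` after time `k` is invisible to `F`.
  let ext : ((i : Finset.Iic k) → S) → ℕ → S := fun p j =>
    if h : j ≤ k then p ⟨j, Finset.mem_Iic.2 h⟩ else s₀
  have hext : Measurable ext := by
    refine measurable_pi_lambda _ fun j => ?_
    by_cases h : j ≤ k
    · simp only [ext, h, dif_pos]; fun_prop
    · simp only [ext, h, dif_neg, not_false_eq_true]; fun_prop
  have hagree : ∀ ω s, F (ext (Preorder.frestrictLe (π := fun _ => S) k ω)) s = F ω s := by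
    intro ω s
    refine hdep _ _ _ fun j hj => ?_
    simp [ext, hj]
  let κ : Kernel ((i : Finset.Iic k) → S) S :=
    (K k).comap (fun p => p ⟨k, Finset.mem_Iic.2 le_rfl⟩) (by fun_prop)
  have key : (chainLaw μ₀ K).map (Preorder.frestrictLe (π := fun _ => S) k) ⊗ₘ κ =
      (chainLaw μ₀ K).map (fun x => (Preorder.frestrictLe (π := fun _ => S) k x, x (k + 1))) := by
    unfold chainLaw
    exact Kernel.map_frestrictLe_trajMeasure_compProd_eq_map_trajMeasure
  let F' : ((i : Finset.Iic k) → S) × S → ℝ := fun p => F (ext p.1) p.2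
  have hF' : Measurable F' := hF.comp (f := fun p : ((i : Finset.Iic k) → S) × S =>
    (ext p.1, p.2)) (by fun_prop)
  have hr : Measurable (Preorder.frestrictLe (π := fun _ => S) k) := by fun_prop
  have : IsProbabilityMeasure
      ((chainLaw μ₀ K).map (Preorder.frestrictLe (π := fun _ => S) k)) :=
    Measure.isProbabilityMeasure_map hr.aemeasurable
  calc ∫ ω, F ω (ω (k + 1)) ∂(chainLaw μ₀ K)
      = ∫ ω, F' (Preorder.frestrictLe (π := fun _ => S) k ω, ω (k + 1)) ∂(chainLaw μ₀ K) := by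
        simp only [F', hagree]
    _ = ∫ p, F' p ∂((chainLaw μ₀ K).map
          (fun x => (Preorder.frestrictLe (π := fun _ => S) k x, x (k + 1)))) := by
        rw [integral_map (by fun_prop) hF'.aestronglyMeasurable]
    _ = ∫ q, ∫ s, F' (q, s) ∂(κ q)
          ∂((chainLaw μ₀ K).map (Preorder.frestrictLe (π := fun _ => S) k)) := by
        rw [← key, Measure.integral_compProd]
        exact Integrable.of_bound hF'.aestronglyMeasurable C
          (ae_of_all _ fun p => by simpa using hC _ _)
    _ = ∫ ω, ∫ s, F' (Preorder.frestrictLe (π := fun _ => S) k ω, s)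
          ∂(κ (Preorder.frestrictLe (π := fun _ => S) k ω)) ∂(chainLaw μ₀ K) := by
        rw [integral_map hr.aemeasurable]
        exact (StronglyMeasurable.integral_kernel_prod_right
          (κ := κ) (f := fun q s => F' (q, s)) hF'.stronglyMeasurable).aestronglyMeasurable
    _ = _ := by
        simp only [F', hagree]
        rfl

end Chain

/-! ### Empirical averages of independent samples -/

section Average

variable {S : Type*} {N : ℕ}

/-- The average of `f` over the particles `x`. -/
noncomputable def average (f : S → ℝ) (x : Fin N → S) : ℝ := (1 / (N : ℝ)) * ∑ i, f (x i)

lemma average_le_average {f g : S → ℝ} (h : ∀ s, f s ≤ g s) (x : Fin N → S) :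
    average f x ≤ average g x :=
  mul_le_mul_of_nonneg_left (Finset.sum_le_sum fun _ _ => h _) (by positivity)

lemma average_const [NeZero N] (c : ℝ) (x : Fin N → S) : average (fun _ => c) x = c := by
  have : (N : ℝ) ≠ 0 := Nat.cast_ne_zero.2 (NeZero.ne N)
  simp [average, this]

lemma average_const_mul (c : ℝ) (f : S → ℝ) (x : Fin N → S) :
    average (fun s => c * f s) x = c * average f x := by
  simp only [average, ← Finset.mul_sum]; ring

lemma average_add (f g : S → ℝ) (x : Fin N → S) :
    average (fun s => f s + g s) x = average f x + average g x := by
  simp only [average, Finset.sum_add_distrib]; ring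

lemma average_sub (f g : S → ℝ) (x : Fin N → S) :
    average (fun s => f s - g s) x = average f x - average g x := by
  simp only [average, Finset.sum_sub_distrib]; ring

lemma abs_average_le (f : S → ℝ) (x : Fin N → S) :
    |average f x| ≤ average (fun s => |f s|) x := by
  unfold average
  rw [abs_mul, abs_of_nonneg (by positivity : (0 : ℝ) ≤ 1 / (N : ℝ))]
  gcongr
  exact Finset.abs_sum_le_sum_abs _ _

lemma abs_average_le_of_le [NeZero N] {f : S → ℝ} {C : ℝ} (h : ∀ s, |f s| ≤ C) (x : Fin N → S) :
    |average f x| ≤ C :=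
  (abs_average_le f x).trans ((average_le_average h x).trans (average_const C x).le)

lemma measurable_average_uncurry [MeasurableSpace S] {α : Type*} [MeasurableSpace α] {F : α → S → ℝ}
    (hF : Measurable (Function.uncurry F)) {X : α → Fin N → S} (hX : Measurable X) :
    Measurable fun a => average (F a) (X a) := by
  unfold average
  refine Measurable.const_mul (Finset.measurable_sum _ fun i _ => ?_) _
  exact hF.comp (f := fun a => (a, X a i)) (by fun_prop)

lemma integral_pi_average [MeasurableSpace S] [NeZero N] (μ : Measure S)
    [IsProbabilityMeasure μ] {f : S → ℝ} (hf : Measurable f) {C : ℝ} (hC : ∀ s, |f s| ≤ C) :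
    ∫ x, average f x ∂(Measure.pi fun _ : Fin N => μ) = ∫ s, f s ∂μ := by
  have hN : (N : ℝ) ≠ 0 := Nat.cast_ne_zero.2 (NeZero.ne N)
  have hi : Integrable f μ := Integrable.of_bound hf.aestronglyMeasurable C (ae_of_all _ hC)
  unfold average
  rw [integral_const_mul, integral_finsetSum]
  · simp_rw [integral_comp_eval (μ := fun _ : Fin N => μ) hi.aestronglyMeasurable]
    simp [hN]
  · exact fun i _ => integrable_comp_eval (μ := fun _ : Fin N => μ) hi

/-- Squared bias plus variance. The variance of the average is `Var f / N` by independence, and is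
bounded through the second moment. -/
lemma integral_pi_sq_average_sub_le [MeasurableSpace S] [NeZero N] (μ : Measure S)
    [IsProbabilityMeasure μ] {f : S → ℝ} (hf : Measurable f) {C : ℝ} (hC : ∀ s, |f s| ≤ C) (p : ℝ) :
    ∫ x, (average f x - p) ^ 2 ∂(Measure.pi fun _ : Fin N => μ) ≤
      (∫ s, f s ∂μ - p) ^ 2 + (1 / (N : ℝ)) * ∫ s, f s ^ 2 ∂μ := by
  have hN : (N : ℝ) ≠ 0 := Nat.cast_ne_zero.2 (NeZero.ne N)
  have hL : MemLp f 2 μ := MemLp.of_bound hf.aestronglyMeasurable C (ae_of_all _ hC)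
  have hA : MemLp (fun x : Fin N → S => average f x) 2 (Measure.pi fun _ : Fin N => μ) :=
    MemLp.of_bound (measurable_average_uncurry (F := fun _ : Fin N → S => f)
      (hf.comp measurable_snd) measurable_id).aestronglyMeasurable C
      (ae_of_all _ fun x => abs_average_le_of_le hC x)
  have hvar : Var[fun x : Fin N → S => average f x; Measure.pi fun _ : Fin N => μ] =
      (1 / (N : ℝ)) * Var[f; μ] := by
    have h := variance_sum_pi (ι := Fin N) (μ := fun _ => μ) (X := fun _ => f) fun _ => hL
    have e : (fun x : Fin N → S => average f x) =
        fun x => (1 / (N : ℝ)) * (∑ i, fun ω : Fin N → S => f (ω i)) x := by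
      ext x; simp [average]
    rw [e, variance_const_mul, h]
    simp; field_simp
  have h1 := variance_eq_sub (hA.sub (memLp_const p))
  have h2 := variance_sub_const (X := fun x : Fin N → S => average f x)
    (μ := Measure.pi fun _ : Fin N => μ) hA.aestronglyMeasurable p
  have h3 : ∫ x, (average f x - p) ∂(Measure.pi fun _ : Fin N => μ) = ∫ s, f s ∂μ - p := by
    rw [integral_sub (hA.integrable one_le_two) (integrable_const p),
      integral_pi_average μ hf hC]
    simp
  have h4 : Var[f; μ] ≤ ∫ s, f s ^ 2 ∂μ := variance_le_expectation_sq hf.aestronglyMeasurable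
  have h5 : ∫ x, (average f x - p) ^ 2 ∂(Measure.pi fun _ : Fin N => μ) =
      (∫ s, f s ∂μ - p) ^ 2 + (1 / (N : ℝ)) * Var[f; μ] := by
    rw [← hvar, ← h2, ← h3]
    simp only [Pi.sub_def, Pi.pow_def] at h1
    linarith
  rw [h5]
  gcongr

end Average

/-! ### Martingale decomposition for a system of particles -/

section ParticleSystem

variable {S : Type*} [MeasurableSpace S] {N : ℕ} [NeZero N] {μ₀ : Measure S}
  [IsProbabilityMeasure μ₀] {κ : ℕ → Kernel (Fin N → S) S} [∀ k, IsMarkovKernel (κ k)]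

/-- Particles that start independently from `μ₀` and move conditionally independently. -/
noncomputable def particleLaw (μ₀ : Measure S) [IsProbabilityMeasure μ₀]
    (κ : ℕ → Kernel (Fin N → S) S) [∀ k, IsMarkovKernel (κ k)] : Measure (ℕ → Fin N → S) :=
  chainLaw (Measure.pi fun _ : Fin N => μ₀) fun k => iidKernel N (κ k)

instance : IsProbabilityMeasure (particleLaw μ₀ κ) := by
  unfold particleLaw; infer_instance

lemma integral_particleLaw_average_zero {f : S → ℝ} (hf : Measurable f) {C : ℝ}
    (hC : ∀ s, |f s| ≤ C) :
    ∫ ω, average f (ω 0) ∂(particleLaw μ₀ κ) = ∫ s, f s ∂μ₀ := by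
  rw [particleLaw, integral_chainLaw_zero (F := fun x => average f x)
    (measurable_average_uncurry (F := fun _ : Fin N → S => f)
      (hf.comp measurable_snd) measurable_id), integral_pi_average μ₀ hf hC]

lemma integral_particleLaw_average_succ (k : ℕ) {U : (ℕ → Fin N → S) → S → ℝ}
    (hU : Measurable (Function.uncurry U)) {C : ℝ} (hC : ∀ ω s, |U ω s| ≤ C)
    (hdep : ∀ ω ω' s, (∀ j ≤ k, ω j = ω' j) → U ω s = U ω' s) :
    ∫ ω, average (U ω) (ω (k + 1)) ∂(particleLaw μ₀ κ) =
      ∫ ω, ∫ s, U ω s ∂(κ k (ω k)) ∂(particleLaw μ₀ κ) := by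
  have hm : ∀ ω, Measurable (U ω) := fun ω => hU.comp measurable_prodMk_left
  rw [particleLaw, integral_chainLaw_succ k (F := fun ω x => average (U ω) x)
    (measurable_average_uncurry (F := fun q : (ℕ → Fin N → S) × (Fin N → S) => U q.1)
      (hU.comp (f := fun q : ((ℕ → Fin N → S) × (Fin N → S)) × S => (q.1.1, q.2))
        (by fun_prop)) measurable_snd) (fun ω x => abs_average_le_of_le (hC ω) x)
    (fun ω ω' x h => by simp only [average, hdep ω ω' _ h])]
  refine integral_congr_ae (ae_of_all _ fun ω => ?_)
  exact integral_pi_average (κ k (ω k)) (hm ω) (hC ω)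

/-- Given the past, the new particles are i.i.d., so the bound for independent samples applies
conditionally. The noise term is left as an average over the new particles, so that pathwise bounds
can be inserted later. -/
lemma integral_particleLaw_sq_average_succ_le (k : ℕ) {U : (ℕ → Fin N → S) → S → ℝ}
    (hU : Measurable (Function.uncurry U)) {C : ℝ} (hC : ∀ ω s, |U ω s| ≤ C)
    (hdep : ∀ ω ω' s, (∀ j ≤ k, ω j = ω' j) → U ω s = U ω' s) (p : ℝ) :
    ∫ ω, (average (U ω) (ω (k + 1)) - p) ^ 2 ∂(particleLaw μ₀ κ) ≤
      ∫ ω, (∫ s, U ω s ∂(κ k (ω k)) - p) ^ 2 ∂(particleLaw μ₀ κ) +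
        (1 / (N : ℝ)) * ∫ ω, average (fun s => U ω s ^ 2) (ω (k + 1)) ∂(particleLaw μ₀ κ) := by
  have hm : ∀ ω, Measurable (U ω) := fun ω => hU.comp measurable_prodMk_left
  have hsq : ∀ ω s, |U ω s ^ 2| ≤ C ^ 2 := fun ω s => by
    rw [abs_pow]; exact pow_le_pow_left₀ (abs_nonneg _) (hC ω s) 2
  rw [integral_particleLaw_average_succ k (U := fun ω s => U ω s ^ 2) (hU.pow_const 2) hsq
    (fun ω ω' s h => by simp only [hdep ω ω' s h])]
  have hker : ∀ {V : (ℕ → Fin N → S) → S → ℝ}, Measurable (Function.uncurry V) →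
      Measurable fun ω => ∫ s, V ω s ∂(κ k (ω k)) := by
    intro V hV
    let κ' : Kernel (ℕ → Fin N → S) S := (κ k).comap (fun ω => ω k) (by fun_prop)
    exact (StronglyMeasurable.integral_kernel_prod_right (κ := κ') (f := V)
      hV.stronglyMeasurable).measurable
  have hint : ∀ (V : (ℕ → Fin N → S) → S → ℝ) (D : ℝ), (∀ ω s, |V ω s| ≤ D) → ∀ ω,
      |∫ s, V ω s ∂(κ k (ω k))| ≤ D := by
    intro V D hD ω
    have := norm_integral_le_of_norm_le_const (μ := κ k (ω k)) (f := V ω)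
      (ae_of_all _ fun s => (Real.norm_eq_abs _).trans_le (hD ω s))
    simpa using this
  rw [particleLaw, integral_chainLaw_succ k (F := fun ω x => (average (U ω) x - p) ^ 2)
    (C := (C + |p|) ^ 2)
    (((measurable_average_uncurry (F := fun q : (ℕ → Fin N → S) × (Fin N → S) => U q.1)
      (hU.comp (f := fun q : ((ℕ → Fin N → S) × (Fin N → S)) × S => (q.1.1, q.2))
        (by fun_prop)) measurable_snd).sub_const p).pow_const 2) (fun ω x => by
        rw [abs_pow]
        refine pow_le_pow_left₀ (abs_nonneg _) ?_ 2
        exact (abs_sub _ _).trans (add_le_add (abs_average_le_of_le (hC ω) x) le_rfl))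
    (fun ω ω' x h => by simp only [average, hdep ω ω' _ h]), ← integral_const_mul,
    ← integral_add]
  · refine integral_mono_of_nonneg (ae_of_all _ fun ω => integral_nonneg fun x => sq_nonneg _) ?_
      (ae_of_all _ fun ω => integral_pi_sq_average_sub_le (κ k (ω k)) (hm ω) (hC ω) p)
    refine Integrable.of_bound (C := (C + |p|) ^ 2 + 1 / (N : ℝ) * C ^ 2)
      ((((hker hU).sub_const p).pow_const 2).add
      ((hker (hU.pow_const 2)).const_mul _)).aestronglyMeasurable (ae_of_all _ fun ω => ?_)
    refine (norm_add_le _ _).trans (add_le_add ?_ ?_)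
    · rw [Real.norm_eq_abs, abs_pow]
      refine pow_le_pow_left₀ (abs_nonneg _) ?_ 2
      exact (abs_sub _ _).trans (add_le_add (hint U C hC ω) le_rfl)
    · rw [Real.norm_eq_abs, abs_mul, abs_of_nonneg (by positivity : (0 : ℝ) ≤ 1 / (N : ℝ))]
      exact mul_le_mul_of_nonneg_left (hint (fun ω s => U ω s ^ 2) _ hsq ω) (by positivity)
  · refine Integrable.of_bound (C := (C + |p|) ^ 2)
      (((hker hU).sub_const p).pow_const 2).aestronglyMeasurable (ae_of_all _ fun ω => ?_)
    rw [Real.norm_eq_abs, abs_pow]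
    refine pow_le_pow_left₀ (abs_nonneg _) ?_ 2
    exact (abs_sub _ _).trans (add_le_add (hint U C hC ω) le_rfl)
  · refine (Integrable.of_bound (C := C ^ 2)
      (hker (hU.pow_const 2)).aestronglyMeasurable (ae_of_all _ fun ω => ?_)).const_mul _
    exact hint (fun ω s => U ω s ^ 2) _ hsq ω

/-- Mean and mean square error of the last term of a sequence of empirical averages which forms a
martingale. -/
theorem average_martingale_mean_sq (n : ℕ) {U : ℕ → (ℕ → Fin N → S) → S → ℝ}
    (hU : ∀ k, Measurable (Function.uncurry (U k))) {C : ℕ → ℝ} (hC : ∀ k ω s, |U k ω s| ≤ C k)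
    (hdep : ∀ k ω ω' s, (∀ j < k, ω j = ω' j) → U k ω s = U k ω' s) {p : ℝ}
    (hp : ∀ ω, ∫ s, U 0 ω s ∂μ₀ = p)
    (hmart : ∀ k, k < n → ∀ ω, ∫ s, U (k + 1) ω s ∂(κ k (ω k)) = average (U k ω) (ω k)) :
    ∫ ω, average (U n ω) (ω n) ∂(particleLaw μ₀ κ) = p ∧
    ∫ ω, (average (U n ω) (ω n) - p) ^ 2 ∂(particleLaw μ₀ κ) ≤
      (1 / (N : ℝ)) * ∑ k ∈ Finset.range (n + 1),
        ∫ ω, average (fun s => U k ω s ^ 2) (ω k) ∂(particleLaw μ₀ κ) := by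
  have hm : ∀ k ω, Measurable (U k ω) := fun k ω => (hU k).comp measurable_prodMk_left
  induction n with
  | zero =>
    obtain ⟨ω₀⟩ : Nonempty (ℕ → Fin N → S) := nonempty_of_isProbabilityMeasure (particleLaw μ₀ κ)
    -- There is no `j < 0`, so `U 0` does not depend on the path and `ω₀` serves as a
    -- representative.
    have e : ∀ ω s, U 0 ω s = U 0 ω₀ s := fun ω s => hdep 0 ω ω₀ s fun j hj => absurd hj (by simp)
    have e' : ∀ ω, U 0 ω = U 0 ω₀ := fun ω => funext (e ω)
    simp only [zero_add, Finset.sum_range_one, e']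
    have hsq : ∀ s, |U 0 ω₀ s ^ 2| ≤ C 0 ^ 2 := fun s => by
      rw [abs_pow]; exact pow_le_pow_left₀ (abs_nonneg _) (hC 0 ω₀ s) 2
    refine ⟨by rw [integral_particleLaw_average_zero (hm 0 ω₀) (hC 0 ω₀), hp], ?_⟩
    rw [integral_particleLaw_average_zero ((hm 0 ω₀).pow_const 2) hsq, particleLaw,
      integral_chainLaw_zero (F := fun x => (average (U 0 ω₀) x - p) ^ 2)
      (((measurable_average_uncurry (F := fun _ : Fin N → S => U 0 ω₀)
      ((hm 0 ω₀).comp measurable_snd) measurable_id).sub_const p).pow_const 2)]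
    refine (integral_pi_sq_average_sub_le μ₀ (hm 0 ω₀) (hC 0 ω₀) p).trans_eq ?_
    rw [hp]; ring
  | succ n ih =>
    obtain ⟨ih1, ih2⟩ := ih fun k hk => hmart k (by omega)
    have hd : ∀ ω ω' s, (∀ j ≤ n, ω j = ω' j) → U (n + 1) ω s = U (n + 1) ω' s :=
      fun ω ω' s h => hdep (n + 1) ω ω' s fun j hj => h j (by omega)
    constructor
    · rw [integral_particleLaw_average_succ n (hU (n + 1)) (hC (n + 1)) hd, ← ih1]
      simp only [hmart n (Nat.lt_succ_self n)]
    -- By `hmart` the conditional mean is the previous average, to which the induction hypothesis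
    -- applies; the noise term is the new summand.
    · refine (integral_particleLaw_sq_average_succ_le n (hU (n + 1)) (hC (n + 1)) hd p).trans ?_
      rw [Finset.sum_range_succ, mul_add]
      simp only [hmart n (Nat.lt_succ_self n)]
      gcongr

end ParticleSystem

/-! ### Bounds for the marginal likelihood and its estimates -/

section Likelihood

variable {E : Type*} [MeasurableSpace E]

lemma measurable_integral_kernel {α : Type*} [MeasurableSpace α] (κ : Kernel α E)
    [IsMarkovKernel κ] {f : E → ℝ} (hf : Measurable f) : Measurable fun a => ∫ x, f x ∂(κ a) :=
  (StronglyMeasurable.integral_kernel_prod_right (κ := κ) (f := fun _ x => f x)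
    (hf.comp measurable_snd).stronglyMeasurable).measurable

lemma integrable_of_abs_le {μ : Measure E} [IsFiniteMeasure μ] {f : E → ℝ} (hf : Measurable f)
    {C : ℝ} (hC : ∀ x, |f x| ≤ C) : Integrable f μ :=
  Integrable.of_bound hf.aestronglyMeasurable C (ae_of_all _ hC)

lemma integral_mem_Icc {μ : Measure E} [IsProbabilityMeasure μ] {f : E → ℝ} {C : ℝ}
    (h : ∀ x, f x ∈ Set.Icc 0 C) : ∫ x, f x ∂μ ∈ Set.Icc 0 C := by
  refine ⟨integral_nonneg fun x => (h x).1, ?_⟩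
  have := norm_integral_le_of_norm_le_const (μ := μ) (f := f) (C := C)
    (ae_of_all _ fun x => by rw [Real.norm_eq_abs, abs_of_nonneg (h x).1]; exact (h x).2)
  simpa using (le_abs_self _).trans this

lemma measurable_marginalLikelihood (Q : Kernel E E) [IsMarkovKernel Q] (n : ℕ)
    (g : ℕ → Potential E) : Measurable (marginalLikelihood Q n g) := by
  induction n generalizing g with
  | zero => exact measurable_const
  | succ n ih => exact measurable_integral_kernel Q ((g 0).measurable.mul (ih _))

lemma marginalLikelihood_mem_Icc (Q : Kernel E E) [IsMarkovKernel Q] {c : ℝ} (n : ℕ)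
    (g : ℕ → Potential E) (hg : ∀ k x, g k x ≤ c) (x : E) :
    marginalLikelihood Q n g x ∈ Set.Icc 0 (c ^ n) := by
  induction n generalizing g x with
  | zero => simp [marginalLikelihood]
  | succ n ih =>
    refine integral_mem_Icc fun x' => ?_
    have h := ih (fun k => g (k + 1)) (fun k => hg _) x'
    have h0 := (g 0).pos x'
    refine ⟨mul_nonneg h0.le h.1, ?_⟩
    rw [pow_succ']
    exact mul_le_mul (hg 0 x') h.2 h.1 (h0.le.trans (hg 0 x'))

/-- `g_k(x) ∫ ∏_{i = k + 1}^{k + r} g_i(x_i) Q(x_{i-1}, dx_i)` for the chain that is at `x` at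
index `k`. -/
noncomputable def backwardLikelihood (Q : Kernel E E) (g : ℕ → Potential E) (r k : ℕ) (x : E) : ℝ :=
  g k x * marginalLikelihood Q r (fun j => g (j + (k + 1))) x

lemma measurable_backwardLikelihood (Q : Kernel E E) [IsMarkovKernel Q] (g : ℕ → Potential E)
    (r k : ℕ) : Measurable (backwardLikelihood Q g r k) :=
  (g k).measurable.mul (measurable_marginalLikelihood Q r _)

lemma backwardLikelihood_mem_Icc (Q : Kernel E E) [IsMarkovKernel Q] {c : ℝ}
    {g : ℕ → Potential E} (hg : ∀ k x, g k x ≤ c) (r k : ℕ) (x : E) :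
    backwardLikelihood Q g r k x ∈ Set.Icc 0 (c ^ (r + 1)) := by
  have h := marginalLikelihood_mem_Icc Q r (fun j => g (j + (k + 1))) (fun j => hg _) x
  have h0 := (g k).pos x
  refine ⟨mul_nonneg h0.le h.1, ?_⟩
  rw [pow_succ']
  exact mul_le_mul (hg k x) h.2 h.1 (h0.le.trans (hg k x))

lemma integral_backwardLikelihood_zero (Q : Kernel E E) (g : ℕ → Potential E) (r : ℕ) (x : E) :
    ∫ x', backwardLikelihood Q g r 0 x' ∂(Q x) = marginalLikelihood Q (r + 1) g x := rfl

/-- The backward recursion behind the martingale property: mutation integrates the next function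
against `Q`, selection supplies the factor `g k`. -/
lemma backwardLikelihood_succ (Q : Kernel E E) (g : ℕ → Potential E) (r k : ℕ) (x : E) :
    backwardLikelihood Q g (r + 1) k x =
      g k x * ∫ x', backwardLikelihood Q g r (k + 1) x' ∂(Q x) := by
  have e : (fun j => g (j + 1 + (k + 1))) = fun j => g (j + (k + 1 + 1)) := by
    funext j; congr 1; omega
  simp only [backwardLikelihood, marginalLikelihood, zero_add, e]

variable {N : ℕ}

lemma likelihoodEstimate_succ (g : ℕ → Potential E) (n : ℕ) (x : ℕ → Fin N → E) :
    likelihoodEstimate g (n + 1) x = likelihoodEstimate g n x * average (g n) (x n) :=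
  Finset.prod_range_succ _ _

lemma measurable_likelihoodEstimate (g : ℕ → Potential E) (n : ℕ) :
    Measurable fun x : ℕ → Fin N → E => likelihoodEstimate g n x := by
  unfold likelihoodEstimate
  refine Finset.measurable_prod _ fun k _ =>
    Measurable.const_mul (Finset.measurable_sum _ fun i _ => ?_) _
  exact (g k).measurable.comp (by fun_prop)

lemma likelihoodEstimate_congr (g : ℕ → Potential E) (n : ℕ) {x x' : ℕ → Fin N → E}
    (h : ∀ k < n, x k = x' k) : likelihoodEstimate g n x = likelihoodEstimate g n x' := by
  unfold likelihoodEstimate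
  refine Finset.prod_congr rfl fun k hk => ?_
  rw [h k (Finset.mem_range.1 hk)]

lemma average_mem_Icc {S : Type*} [NeZero N] {f : S → ℝ} {c : ℝ}
    (h : ∀ x, f x ∈ Set.Icc 0 c) (x : Fin N → S) : average f x ∈ Set.Icc 0 c := by
  refine ⟨mul_nonneg (by positivity) (Finset.sum_nonneg fun i _ => (h _).1), ?_⟩
  exact (average_le_average (fun s => (h s).2) x).trans_eq (average_const c x)

lemma likelihoodEstimate_mem_Icc [NeZero N] {g : ℕ → Potential E} {c : ℝ}
    (hg : ∀ k x, g k x ≤ c) (n : ℕ) (x : ℕ → Fin N → E) :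
    likelihoodEstimate g n x ∈ Set.Icc 0 (c ^ n) := by
  induction n with
  | zero => simp [likelihoodEstimate]
  | succ n ih =>
    have h := average_mem_Icc (fun s => ⟨((g n).pos s).le, hg n s⟩) (x n)
    rw [likelihoodEstimate_succ, pow_succ]
    exact ⟨mul_nonneg ih.1 h.1, mul_le_mul ih.2 h.2 h.1 (ih.1.trans ih.2)⟩

end Likelihood

/-! ### Selection steps -/

section Selection

variable {E : Type*} [MeasurableSpace E] {N : ℕ}

/-- The cancellation behind unbiasedness: the random normalisation of the weights is `N` times the
factor by which the likelihood estimate is multiplied. -/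
lemma average_mul_sum_weight (g : Potential E) (x : Fin N → E) (f : E → ℝ) :
    average g x * ∑ i, weight g x i * f (x i) = average (fun s => g s * f s) x := by
  rcases Nat.eq_zero_or_pos N with rfl | hN
  · simp [average]
  have : Nonempty (Fin N) := ⟨⟨0, hN⟩⟩
  have h : ∑ j, g (x j) ≠ 0 :=
    (Finset.sum_pos (fun _ _ => g.pos _) Finset.univ_nonempty).ne'
  have e : ∑ i, weight g x i * f (x i) = (∑ i, g (x i) * f (x i)) / ∑ j, g (x j) := by
    rw [Finset.sum_div]
    exact Finset.sum_congr rfl fun i _ => div_mul_eq_mul_div _ _ _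
  rw [e, average, average]
  field_simp

lemma integral_selectMove (g : Potential E) (Q : Kernel E E) [IsMarkovKernel Q]
    (x : Fin N → E) {f : E → ℝ} (hf : Measurable f) {C : ℝ} (hC : ∀ x, |f x| ≤ C) :
    ∫ x', f x' ∂(selectMove g Q N x) = ∑ i, weight g x i * ∫ x', f x' ∂(Q (x i)) := by
  change ∫ x', f x' ∂(∑ i, ENNReal.ofReal (weight g x i) • Q (x i)) = _
  rw [integral_finsetSum_measure fun i _ =>
    (integrable_of_abs_le hf hC).smul_measure ENNReal.ofReal_ne_top]
  refine Finset.sum_congr rfl fun i _ => ?_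
  rw [integral_smul_measure, ENNReal.toReal_ofReal (weight_nonneg g x i), smul_eq_mul]

lemma integral_coupledSelectMove (g : Potential E) (M : Kernel (E × E) (E × E))
    [IsMarkovKernel M] (hN : 0 < N) (v : Fin N → E × E) {f : E × E → ℝ} (hf : Measurable f)
    {C : ℝ} (hC : ∀ x, |f x| ≤ C) :
    ∫ z, f z ∂(coupledSelectMove g M N v) = ∑ i, ∑ j,
      coupledResampling (weight g fun s => (v s).1) (weight g fun s => (v s).2) i j *
        ∫ z, f z ∂(M ((v i).1, (v j).2)) := by
  have hr := coupledResampling_nonneg (weight_nonneg g fun s => (v s).1)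
    (weight_nonneg g fun s => (v s).2) (sum_weight g _ hN)
  change ∫ z, f z ∂(∑ i, ∑ j, ENNReal.ofReal
    (coupledResampling (weight g fun s => (v s).1) (weight g fun s => (v s).2) i j) •
      M ((v i).1, (v j).2)) = _
  have hI : ∀ i j, Integrable f (ENNReal.ofReal (coupledResampling (weight g fun s => (v s).1)
      (weight g fun s => (v s).2) i j) • M ((v i).1, (v j).2)) := fun i j =>
    (integrable_of_abs_le hf hC).smul_measure ENNReal.ofReal_ne_top
  rw [integral_finsetSum_measure fun i _ => (integrable_finsetSum_measure.2 fun j _ => hI i j)]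
  refine Finset.sum_congr rfl fun i _ => ?_
  rw [integral_finsetSum_measure fun j _ => hI i j]
  refine Finset.sum_congr rfl fun j _ => ?_
  rw [integral_smul_measure, ENNReal.toReal_ofReal (hr i j), smul_eq_mul]

/-- Both residuals have mass `1 - α`, so the mixture returns `m + (w₁ - m)`. When `α = 0` all minima
vanish and when `α = 1` all residuals vanish, which agrees with division by zero being zero. -/
lemma sum_coupledResampling_right {w₁ w₂ : Fin N → ℝ} (h₁ : ∀ i, 0 ≤ w₁ i) (h₂ : ∀ i, 0 ≤ w₂ i)
    (s₁ : ∑ i, w₁ i = 1) (s₂ : ∑ i, w₂ i = 1) (i : Fin N) :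
    ∑ j, coupledResampling w₁ w₂ i j = w₁ i := by
  have hm : ∀ s, 0 ≤ min (w₁ s) (w₂ s) := fun s => le_min (h₁ s) (h₂ s)
  simp only [coupledResampling, Finset.sum_add_distrib, ← Finset.mul_sum, Finset.sum_ite_eq,
    Finset.mem_univ, if_true, ← Finset.sum_div, Finset.sum_sub_distrib, s₁, s₂]
  set α := ∑ s, min (w₁ s) (w₂ s) with hα
  have e : α * (min (w₁ i) (w₂ i) / α) = min (w₁ i) (w₂ i) := by
    rcases eq_or_ne α 0 with h | h
    · have : min (w₁ i) (w₂ i) = 0 :=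
        (Finset.sum_eq_zero_iff_of_nonneg fun s _ => hm s).1 (hα ▸ h) i (Finset.mem_univ i)
      simp [this]
    · field_simp
  rw [e]
  rcases eq_or_ne (1 - α) 0 with h | h
  · have : w₁ i - min (w₁ i) (w₂ i) = 0 := by
      refine (Finset.sum_eq_zero_iff_of_nonneg
        (f := fun s => w₁ s - min (w₁ s) (w₂ s)) fun s _ => sub_nonneg.2 (min_le_left _ _)).1 ?_ i
        (Finset.mem_univ i)
      rw [Finset.sum_sub_distrib, s₁, ← hα, h]
    rw [h]; linarith
  · field_simp; ring

lemma coupledResampling_swap (w₁ w₂ : Fin N → ℝ) (s₁ : ∑ i, w₁ i = 1) (s₂ : ∑ i, w₂ i = 1)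
    (i j : Fin N) : coupledResampling w₁ w₂ i j = coupledResampling w₂ w₁ j i := by
  simp only [coupledResampling, min_comm (w₁ _), Finset.sum_sub_distrib, s₁, s₂]
  rcases eq_or_ne i j with rfl | h
  · simp only [if_true]; ring
  · simp only [if_neg h, if_neg h.symm]; ring

lemma sum_coupledResampling_left {w₁ w₂ : Fin N → ℝ} (h₁ : ∀ i, 0 ≤ w₁ i) (h₂ : ∀ i, 0 ≤ w₂ i)
    (s₁ : ∑ i, w₁ i = 1) (s₂ : ∑ i, w₂ i = 1) (j : Fin N) :
    ∑ i, coupledResampling w₁ w₂ i j = w₂ j := by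
  simp only [coupledResampling_swap w₁ w₂ s₁ s₂]
  exact sum_coupledResampling_right h₂ h₁ s₂ s₁ j

variable {Q₁ Q₂ : Kernel E E} {M : Kernel (E × E) (E × E)}

lemma integral_fst_of_map_eq (h : ∀ x x', (M (x, x')).map Prod.fst = Q₁ x) {f : E → ℝ}
    (hf : Measurable f) (p : E × E) : ∫ z, f z.1 ∂(M p) = ∫ x, f x ∂(Q₁ p.1) := by
  rw [← h p.1 p.2, integral_map (by fun_prop) hf.aestronglyMeasurable]

lemma integral_snd_of_map_eq (h : ∀ x x', (M (x, x')).map Prod.snd = Q₂ x') {f : E → ℝ}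
    (hf : Measurable f) (p : E × E) : ∫ z, f z.2 ∂(M p) = ∫ x, f x ∂(Q₂ p.2) := by
  rw [← h p.1 p.2, integral_map (by fun_prop) hf.aestronglyMeasurable]

lemma integral_fst_coupledSelectMove [IsMarkovKernel M] (g : Potential E)
    (h : ∀ x x', (M (x, x')).map Prod.fst = Q₁ x) (hN : 0 < N) (v : Fin N → E × E) {f : E → ℝ}
    (hf : Measurable f) {C : ℝ} (hC : ∀ x, |f x| ≤ C) :
    ∫ z, f z.1 ∂(coupledSelectMove g M N v) =
      ∑ i, weight g (fun s => (v s).1) i * ∫ x, f x ∂(Q₁ (v i).1) := by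
  rw [integral_coupledSelectMove g M hN v (f := fun z => f z.1) (hf.comp measurable_fst)
    fun z => hC z.1]
  refine Finset.sum_congr rfl fun i _ => ?_
  simp only [integral_fst_of_map_eq h hf, ← Finset.sum_mul]
  rw [sum_coupledResampling_right (weight_nonneg g _) (weight_nonneg g _) (sum_weight g _ hN)
    (sum_weight g _ hN)]

lemma integral_snd_coupledSelectMove [IsMarkovKernel M] (g : Potential E)
    (h : ∀ x x', (M (x, x')).map Prod.snd = Q₂ x') (hN : 0 < N) (v : Fin N → E × E) {f : E → ℝ}
    (hf : Measurable f) {C : ℝ} (hC : ∀ x, |f x| ≤ C) :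
    ∫ z, f z.2 ∂(coupledSelectMove g M N v) =
      ∑ i, weight g (fun s => (v s).2) i * ∫ x, f x ∂(Q₂ (v i).2) := by
  rw [integral_coupledSelectMove g M hN v (f := fun z => f z.2) (hf.comp measurable_snd)
    fun z => hC z.2, Finset.sum_comm]
  refine Finset.sum_congr rfl fun i _ => ?_
  simp only [integral_snd_of_map_eq h hf, ← Finset.sum_mul]
  rw [sum_coupledResampling_left (weight_nonneg g _) (weight_nonneg g _) (sum_weight g _ hN)
    (sum_weight g _ hN)]

end Selection

/-! ### The particle filter -/

section Filter

variable {E : Type*} [MeasurableSpace E] {N : ℕ}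

lemma abs_le_of_mem_Icc {a b : ℝ} (h : a ∈ Set.Icc 0 b) : |a| ≤ b := by
  rw [abs_of_nonneg h.1]; exact h.2

/-- The martingale is the average of `U k`, the estimate from the first `k` observations times the
backward likelihood of the remaining ones. The two factors are at most `c ^ k` and `c ^ (n - k +
1)`. -/
theorem filterLaw_mean_sq [NeZero N] (g : ℕ → Potential E) (Q : Kernel E E) [IsMarkovKernel Q] (x₀ : E)
    {c : ℝ} (hg : ∀ k x, g k x ≤ c) (n : ℕ) :
    ∫ ω, likelihoodEstimate g (n + 1) ω ∂(filterLaw g Q x₀ N) =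
        marginalLikelihood Q (n + 1) g x₀ ∧
    ∫ ω, (likelihoodEstimate g (n + 1) ω - marginalLikelihood Q (n + 1) g x₀) ^ 2
        ∂(filterLaw g Q x₀ N) ≤
      (1 / (N : ℝ)) * ∑ k ∈ Finset.range (n + 1), (c ^ k * c ^ (n - k + 1)) ^ 2 := by
  let U : ℕ → (ℕ → Fin N → E) → E → ℝ := fun k ω s =>
    likelihoodEstimate g k ω * backwardLikelihood Q g (n - k) k s
  have hB := fun k => measurable_backwardLikelihood Q g (n - k) k
  have hBI := fun k => backwardLikelihood_mem_Icc Q hg (n - k) k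
  have hUI : ∀ k ω s, U k ω s ∈ Set.Icc 0 (c ^ k * c ^ (n - k + 1)) := fun k ω s => by
    have h1 := likelihoodEstimate_mem_Icc hg k ω
    have h2 := hBI k s
    exact ⟨mul_nonneg h1.1 h2.1, mul_le_mul h1.2 h2.2 h2.1 (h1.1.trans h1.2)⟩
  have hUm : ∀ k, Measurable (Function.uncurry (U k)) := fun k =>
    ((measurable_likelihoodEstimate g k).comp measurable_fst).mul ((hB k).comp measurable_snd)
  -- At `k = n` nothing is left after index `n`, so the backward likelihood is `g n` alone.
  have hlast : ∀ ω, average (U n ω) (ω n) = likelihoodEstimate g (n + 1) ω := fun ω => by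
    rw [likelihoodEstimate_succ, ← average_const_mul]
    simp [U, backwardLikelihood, marginalLikelihood]
  have key := average_martingale_mean_sq (μ₀ := Q x₀) (κ := fun k => selectMove (g k) Q N) n
    (U := U) (C := fun k => c ^ k * c ^ (n - k + 1)) (p := marginalLikelihood Q (n + 1) g x₀) hUm
    (fun k ω s => abs_le_of_mem_Icc (hUI k ω s))
    (fun k ω ω' s h => by simp only [U, likelihoodEstimate_congr g k h])
    (fun ω => by
      simp only [U, Nat.sub_zero, likelihoodEstimate, Finset.range_zero, Finset.prod_empty,
        one_mul]
      exact integral_backwardLikelihood_zero Q g n x₀)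
    (fun k hk ω => by
      simp only [U]
      rw [integral_const_mul, integral_selectMove (g k) Q _ (hB (k + 1))
        fun x => abs_le_of_mem_Icc (hBI (k + 1) x), likelihoodEstimate_succ, mul_assoc,
        average_mul_sum_weight (g k) (ω k)
        (fun x => ∫ x', backwardLikelihood Q g (n - (k + 1)) (k + 1) x' ∂(Q x)),
        ← average_const_mul]
      obtain ⟨r, rfl⟩ : ∃ r, n = k + 1 + r := ⟨n - (k + 1), by omega⟩
      have e1 : k + 1 + r - (k + 1) = r := by omega
      have e2 : k + 1 + r - k = r + 1 := by omega
      simp only [e1, e2, backwardLikelihood_succ])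
  simp only [hlast] at key
  refine ⟨key.1, key.2.trans ?_⟩
  gcongr with k hk
  refine (integral_mem_Icc fun ω : ℕ → Fin N → E => average_mem_Icc (fun s => ?_) (ω k)).2
  exact ⟨sq_nonneg _, pow_le_pow_left₀ (hUI k ω s).1 (hUI k ω s).2 2⟩

/-- The increment of the martingale behind the coupled particle filter: the change of the
difference of the two estimates that is due to one pair `s` at index `k`. -/
noncomputable def coupledIncrement (g : ℕ → Potential E) (Q₁ Q₂ : Kernel E E) (n k : ℕ)
    (ω : ℕ → Fin N → E × E) (s : E × E) : ℝ :=
  likelihoodEstimate g k (fun k i => (ω k i).1) * backwardLikelihood Q₁ g (n - k) k s.1 -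
    likelihoodEstimate g k (fun k i => (ω k i).2) * backwardLikelihood Q₂ g (n - k) k s.2

lemma measurable_coupledIncrement (g : ℕ → Potential E) (Q₁ Q₂ : Kernel E E) [IsMarkovKernel Q₁]
    [IsMarkovKernel Q₂] (n k : ℕ) :
    Measurable (Function.uncurry (coupledIncrement (N := N) g Q₁ Q₂ n k)) := by
  refine Measurable.sub (Measurable.mul ?_ ?_) (Measurable.mul ?_ ?_)
  · exact (measurable_likelihoodEstimate g k).comp
      (f := fun p : (ℕ → Fin N → E × E) × (E × E) => fun k i => (p.1 k i).1) (by fun_prop)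
  · exact (measurable_backwardLikelihood Q₁ g (n - k) k).comp (by fun_prop)
  · exact (measurable_likelihoodEstimate g k).comp
      (f := fun p : (ℕ → Fin N → E × E) × (E × E) => fun k i => (p.1 k i).2) (by fun_prop)
  · exact (measurable_backwardLikelihood Q₂ g (n - k) k).comp (by fun_prop)

lemma abs_coupledIncrement_le [NeZero N] {g : ℕ → Potential E} (Q₁ Q₂ : Kernel E E) [IsMarkovKernel Q₁]
    [IsMarkovKernel Q₂] {c : ℝ} (hg : ∀ k x, g k x ≤ c) (n k : ℕ) (ω : ℕ → Fin N → E × E)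
    (s : E × E) : |coupledIncrement g Q₁ Q₂ n k ω s| ≤ c ^ k * c ^ (n - k + 1) := by
  have h : ∀ (Q : Kernel E E) [IsMarkovKernel Q] (x : ℕ → Fin N → E) (s : E),
      likelihoodEstimate g k x * backwardLikelihood Q g (n - k) k s ∈
        Set.Icc 0 (c ^ k * c ^ (n - k + 1)) := fun Q _ x s => by
    have h1 := likelihoodEstimate_mem_Icc hg k x
    have h2 := backwardLikelihood_mem_Icc Q hg (n - k) k s
    exact ⟨mul_nonneg h1.1 h2.1, mul_le_mul h1.2 h2.2 h2.1 (h1.1.trans h1.2)⟩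
  have h1 := h Q₁ (fun k i => (ω k i).1) s.1
  have h2 := h Q₂ (fun k i => (ω k i).2) s.2
  unfold coupledIncrement
  rw [abs_le]
  constructor <;> linarith [h1.1, h1.2, h2.1, h2.2]

/-- The martingale property is linear in the two components, so it needs only the marginals of the
resampling and of `M`. The quality of the coupling enters only through the mean squares on the
right, still to be estimated. -/
theorem coupledFilterLaw_mean_sq [NeZero N] (g : ℕ → Potential E) {Q₁ Q₂ : Kernel E E} [IsMarkovKernel Q₁]
    [IsMarkovKernel Q₂] {M : Kernel (E × E) (E × E)} [IsMarkovKernel M]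
    (hM₁ : ∀ x x', (M (x, x')).map Prod.fst = Q₁ x)
    (hM₂ : ∀ x x', (M (x, x')).map Prod.snd = Q₂ x') (x₀ : E) {c : ℝ} (hg : ∀ k x, g k x ≤ c)
    (n : ℕ) :
    ∫ ω : ℕ → Fin N → E × E, (likelihoodEstimate g (n + 1) (fun k i => (ω k i).1) -
        likelihoodEstimate g (n + 1) (fun k i => (ω k i).2)) ∂(coupledFilterLaw g M x₀ N) =
      marginalLikelihood Q₁ (n + 1) g x₀ - marginalLikelihood Q₂ (n + 1) g x₀ ∧
    ∫ ω : ℕ → Fin N → E × E, (likelihoodEstimate g (n + 1) (fun k i => (ω k i).1) -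
        likelihoodEstimate g (n + 1) (fun k i => (ω k i).2) -
        (marginalLikelihood Q₁ (n + 1) g x₀ - marginalLikelihood Q₂ (n + 1) g x₀)) ^ 2
        ∂(coupledFilterLaw g M x₀ N) ≤
      (1 / (N : ℝ)) * ∑ k ∈ Finset.range (n + 1),
        ∫ ω : ℕ → Fin N → E × E, average (fun s => coupledIncrement g Q₁ Q₂ n k ω s ^ 2) (ω k)
          ∂(coupledFilterLaw g M x₀ N) := by
  have hB : ∀ (Q : Kernel E E) [IsMarkovKernel Q] (r k : ℕ) (x : E),
      |backwardLikelihood Q g r k x| ≤ c ^ (r + 1) :=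
    fun Q _ r k x => abs_le_of_mem_Icc (backwardLikelihood_mem_Icc Q hg r k x)
  have hI₁ : ∀ (r k : ℕ) (μ : Measure (E × E)) [IsProbabilityMeasure μ],
      Integrable (fun s : E × E => backwardLikelihood Q₁ g r k s.1) μ := fun r k μ _ =>
    integrable_of_abs_le ((measurable_backwardLikelihood Q₁ g r k).comp measurable_fst)
      fun s => hB Q₁ r k s.1
  have hI₂ : ∀ (r k : ℕ) (μ : Measure (E × E)) [IsProbabilityMeasure μ],
      Integrable (fun s : E × E => backwardLikelihood Q₂ g r k s.2) μ := fun r k μ _ =>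
    integrable_of_abs_le ((measurable_backwardLikelihood Q₂ g r k).comp measurable_snd)
      fun s => hB Q₂ r k s.2
  have hlast : ∀ ω : ℕ → Fin N → E × E, average (coupledIncrement g Q₁ Q₂ n n ω) (ω n) =
      likelihoodEstimate g (n + 1) (fun k i => (ω k i).1) -
        likelihoodEstimate g (n + 1) (fun k i => (ω k i).2) := fun ω => by
    unfold coupledIncrement
    rw [average_sub, average_const_mul, average_const_mul, likelihoodEstimate_succ,
      likelihoodEstimate_succ]
    simp [backwardLikelihood, marginalLikelihood, average]
  have key := average_martingale_mean_sq (μ₀ := M (x₀, x₀))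
    (κ := fun k => coupledSelectMove (g k) M N) n (U := coupledIncrement g Q₁ Q₂ n)
    (C := fun k => c ^ k * c ^ (n - k + 1))
    (p := marginalLikelihood Q₁ (n + 1) g x₀ - marginalLikelihood Q₂ (n + 1) g x₀)
    (measurable_coupledIncrement g Q₁ Q₂ n)
    (fun k ω s => abs_coupledIncrement_le Q₁ Q₂ hg n k ω s)
    (fun k ω ω' s h => by
      unfold coupledIncrement
      rw [likelihoodEstimate_congr g k (x := fun k i => (ω k i).1)
        (x' := fun k i => (ω' k i).1) fun j hj => by rw [h j hj],
        likelihoodEstimate_congr g k (x := fun k i => (ω k i).2)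
        (x' := fun k i => (ω' k i).2) fun j hj => by rw [h j hj]])
    (fun ω => by
      simp only [coupledIncrement, Nat.sub_zero, likelihoodEstimate, Finset.range_zero,
        Finset.prod_empty, one_mul]
      rw [integral_sub (hI₁ n 0 _) (hI₂ n 0 _),
        integral_fst_of_map_eq hM₁ (measurable_backwardLikelihood Q₁ g n 0),
        integral_snd_of_map_eq hM₂ (measurable_backwardLikelihood Q₂ g n 0)]
      rfl)
    (fun k hk ω => by
      unfold coupledIncrement
      rw [integral_sub ((hI₁ _ _ _).const_mul _) ((hI₂ _ _ _).const_mul _), integral_const_mul,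
        integral_const_mul, integral_fst_coupledSelectMove (g k) hM₁ (NeZero.pos N) _
        (measurable_backwardLikelihood Q₁ g _ _) (hB Q₁ _ _),
        integral_snd_coupledSelectMove (g k) hM₂ (NeZero.pos N) _
        (measurable_backwardLikelihood Q₂ g _ _) (hB Q₂ _ _), likelihoodEstimate_succ,
        likelihoodEstimate_succ, mul_assoc, mul_assoc,
        average_mul_sum_weight (g k) (fun s => (ω k s).1)
        (fun x => ∫ x', backwardLikelihood Q₁ g (n - (k + 1)) (k + 1) x' ∂(Q₁ x)),
        average_mul_sum_weight (g k) (fun s => (ω k s).2)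
        (fun x => ∫ x', backwardLikelihood Q₂ g (n - (k + 1)) (k + 1) x' ∂(Q₂ x)),
        average_sub, average_const_mul, average_const_mul]
      obtain ⟨r, rfl⟩ : ∃ r, n = k + 1 + r := ⟨n - (k + 1), by omega⟩
      have e1 : k + 1 + r - (k + 1) = r := by omega
      have e2 : k + 1 + r - k = r + 1 := by omega
      simp only [e1, e2, backwardLikelihood_succ]
      rfl)
  simp only [hlast] at key
  exact key

end Filter

/-! ### Closeness of the two components of a coupled particle filter -/

section Coupled

variable {E : Type*} [MeasurableSpace E]

/-- `Ψ` takes values in `[0, 1]`, controls the oscillation of the potentials, which lie in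
`[c⁻¹, c]`, and is stable under the kernel `M`. -/
structure IsCouplingControl (g : ℕ → Potential E) (M : Kernel (E × E) (E × E)) (A c : ℝ)
    (Ψ : E × E → ℝ) : Prop where
  one_le : 1 ≤ c
  nonneg : 0 ≤ A
  inv_le : ∀ k x, c⁻¹ ≤ g k x
  le : ∀ k x, g k x ≤ c
  measurable : Measurable Ψ
  mem_Icc : ∀ p, Ψ p ∈ Set.Icc 0 1
  abs_sub_le : ∀ k x x', |g k x - g k x'| ≤ A * Ψ (x, x')
  integral_le : ∀ p, ∫ z, Ψ z ∂(M p) ≤ A * Ψ p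

lemma abs_mul_sub_mul_le {a b p q P B : ℝ} (hp : |p| ≤ P) (hb : |b| ≤ B) :
    |a * p - b * q| ≤ |a - b| * P + B * |p - q| := by
  have e : a * p - b * q = (a - b) * p + b * (p - q) := by ring
  rw [e]
  refine (abs_add_le _ _).trans ?_
  rw [abs_mul, abs_mul]
  gcongr

/-- Constant in the bound for the difference of the backward likelihoods of two kernels. -/
noncomputable def backwardConst (A c : ℝ) : ℕ → ℝ
  | 0 => A
  | r + 1 => A * c ^ (r + 1) + c * (A * backwardConst A c r)

lemma backwardConst_nonneg {A c : ℝ} (hA : 0 ≤ A) (hc : 0 ≤ c) (r : ℕ) :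
    0 ≤ backwardConst A c r := by
  induction r with
  | zero => exact hA
  | succ r ih => unfold backwardConst; positivity

/-- Growth factor of the mean distance between the two components in a selection step. -/
noncomputable def selectionConst (A c : ℝ) : ℝ := c ^ 2 * A + 2 * c * A

/-- Constant in the mean square error bound for a coupled particle filter. -/
noncomputable def filterConst (A c : ℝ) (n : ℕ) : ℝ :=
  ∑ k ∈ Finset.range (n + 1), c ^ k * c ^ (n - k + 1) *
    (c ^ k * c ^ (n - k + 1) * A * (∑ j ∈ Finset.range k, selectionConst A c ^ j * A) +
      c ^ k * backwardConst A c (n - k) * (selectionConst A c ^ k * A))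

variable {g : ℕ → Potential E} {M : Kernel (E × E) (E × E)} {A c : ℝ} {Ψ : E × E → ℝ} {N : ℕ}

namespace IsCouplingControl

/-- Since `M` couples `Q₁` and `Q₂`, the difference of the two integrals is one integral over `M` of
a difference, which by induction is bounded by the integral of `Ψ`. -/
lemma abs_backwardLikelihood_sub_le (h : IsCouplingControl g M A c Ψ) {Q₁ Q₂ : Kernel E E}
    [IsMarkovKernel Q₁] [IsMarkovKernel Q₂] [IsMarkovKernel M]
    (hM₁ : ∀ x x', (M (x, x')).map Prod.fst = Q₁ x)
    (hM₂ : ∀ x x', (M (x, x')).map Prod.snd = Q₂ x') (r k : ℕ) (x x' : E) :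
    |backwardLikelihood Q₁ g r k x - backwardLikelihood Q₂ g r k x'| ≤
      backwardConst A c r * Ψ (x, x') := by
  have hc : 0 ≤ c := zero_le_one.trans h.one_le
  induction r generalizing k x x' with
  | zero => simpa [backwardLikelihood, marginalLikelihood, backwardConst] using h.abs_sub_le k x x'
  | succ r ih =>
    have hB : ∀ (Q : Kernel E E) [IsMarkovKernel Q] (x : E),
        |backwardLikelihood Q g r (k + 1) x| ≤ c ^ (r + 1) := fun Q _ x =>
      abs_le_of_mem_Icc (backwardLikelihood_mem_Icc Q h.le r (k + 1) x)
    have hm₁ := measurable_backwardLikelihood Q₁ g r (k + 1)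
    have hm₂ := measurable_backwardLikelihood Q₂ g r (k + 1)
    have h1 : |∫ z, backwardLikelihood Q₁ g r (k + 1) z ∂(Q₁ x)| ≤ c ^ (r + 1) :=
      abs_le_of_mem_Icc (integral_mem_Icc fun z => backwardLikelihood_mem_Icc Q₁ h.le r (k + 1) z)
    have h2 : |∫ z, backwardLikelihood Q₁ g r (k + 1) z ∂(Q₁ x) -
        ∫ z, backwardLikelihood Q₂ g r (k + 1) z ∂(Q₂ x')| ≤
        backwardConst A c r * (A * Ψ (x, x')) := by
      rw [← integral_fst_of_map_eq hM₁ hm₁ (x, x'), ← integral_snd_of_map_eq hM₂ hm₂ (x, x'),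
        ← integral_sub (integrable_of_abs_le (f := fun z : E × E =>
          backwardLikelihood Q₁ g r (k + 1) z.1) (hm₁.comp measurable_fst) fun z => hB Q₁ z.1)
        (integrable_of_abs_le (f := fun z : E × E => backwardLikelihood Q₂ g r (k + 1) z.2)
          (hm₂.comp measurable_snd) fun z => hB Q₂ z.2)]
      refine (abs_integral_le_integral_abs).trans ?_
      calc _ ≤ ∫ z, backwardConst A c r * Ψ z ∂(M (x, x')) := by
            refine integral_mono_of_nonneg (ae_of_all _ fun z => abs_nonneg _)
              ((integrable_of_abs_le h.measurable fun z =>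
                abs_le_of_mem_Icc (h.mem_Icc z)).const_mul _)
              (ae_of_all _ fun z => ih (k + 1) z.1 z.2)
        _ ≤ _ := by
            rw [integral_const_mul]
            exact mul_le_mul_of_nonneg_left (h.integral_le _)
              (backwardConst_nonneg h.nonneg hc r)
    rw [backwardLikelihood_succ, backwardLikelihood_succ, backwardConst]
    refine (abs_mul_sub_mul_le h1 (b := g k x') (B := c) ?_).trans ?_
    · rw [abs_of_pos ((g k).pos x')]; exact h.le k x'
    · calc _ ≤ A * Ψ (x, x') * c ^ (r + 1) + c * (backwardConst A c r * (A * Ψ (x, x'))) := by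
            gcongr
            exact h.abs_sub_le k x x'
        _ = _ := by ring

lemma abs_average_sub_le (h : IsCouplingControl g M A c Ψ) (k : ℕ) (v : Fin N → E × E) :
    |average (g k) (fun i => (v i).1) - average (g k) (fun i => (v i).2)| ≤ A * average Ψ v := by
  have e : average (g k) (fun i => (v i).1) - average (g k) (fun i => (v i).2) =
      average (fun s : E × E => g k s.1 - g k s.2) v := by
    rw [average_sub]; rfl
  rw [e, ← average_const_mul]
  exact (abs_average_le _ _).trans (average_le_average (fun s => h.abs_sub_le k s.1 s.2) v)

lemma average_nonneg (h : IsCouplingControl g M A c Ψ) (v : Fin N → E × E) : 0 ≤ average Ψ v :=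
  mul_nonneg (by positivity) (Finset.sum_nonneg fun i _ => (h.mem_Icc _).1)

lemma abs_likelihoodEstimate_sub_le [NeZero N] (h : IsCouplingControl g M A c Ψ) (k : ℕ)
    (ω : ℕ → Fin N → E × E) :
    |likelihoodEstimate g k (fun k i => (ω k i).1) -
        likelihoodEstimate g k (fun k i => (ω k i).2)| ≤
      c ^ k * A * ∑ j ∈ Finset.range k, average Ψ (ω j) := by
  have hc : 0 ≤ c := zero_le_one.trans h.one_le
  have hA := h.nonneg
  induction k with
  | zero => simp [likelihoodEstimate]
  | succ k ih =>
    rw [likelihoodEstimate_succ, likelihoodEstimate_succ, Finset.sum_range_succ]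
    refine (abs_mul_sub_mul_le (P := c) (B := c ^ k) ?_ ?_).trans ?_
    · exact abs_le_of_mem_Icc (average_mem_Icc (fun s => ⟨((g k).pos s).le, h.le k s⟩) _)
    · exact abs_le_of_mem_Icc (likelihoodEstimate_mem_Icc h.le k _)
    · have h2 := h.abs_average_sub_le k (ω k)
      -- Wasting a factor `c` in the new term gives all terms of the sum the same prefactor.
      have h3 : c ^ k ≤ c ^ (k + 1) := pow_le_pow_right₀ h.one_le (Nat.le_succ k)
      have h4 := h.average_nonneg (ω k)
      calc _ ≤ (c ^ k * A * ∑ j ∈ Finset.range k, average Ψ (ω j)) * c +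
            c ^ (k + 1) * (A * average Ψ (ω k)) := by gcongr
        _ = _ := by ring

/-- Only one factor of the square is estimated by closeness; the other gets the crude bound. The
result is linear in `Ψ`, whose mean is what the selection steps control. -/
lemma average_sq_coupledIncrement_le [NeZero N] (h : IsCouplingControl g M A c Ψ)
    {Q₁ Q₂ : Kernel E E} [IsMarkovKernel Q₁] [IsMarkovKernel Q₂] [IsMarkovKernel M]
    (hM₁ : ∀ x x', (M (x, x')).map Prod.fst = Q₁ x)
    (hM₂ : ∀ x x', (M (x, x')).map Prod.snd = Q₂ x') (n k : ℕ) (ω : ℕ → Fin N → E × E) :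
    average (fun s => coupledIncrement g Q₁ Q₂ n k ω s ^ 2) (ω k) ≤
      c ^ k * c ^ (n - k + 1) *
        (c ^ k * c ^ (n - k + 1) * A * (∑ j ∈ Finset.range k, average Ψ (ω j)) +
          c ^ k * backwardConst A c (n - k) * average Ψ (ω k)) := by
  have hc : 0 ≤ c := zero_le_one.trans h.one_le
  rw [← average_const_mul (c ^ k * backwardConst A c (n - k)),
    ← average_const (c ^ k * c ^ (n - k + 1) * A * (∑ j ∈ Finset.range k, average Ψ (ω j))) (ω k),
    ← average_add, ← average_const_mul]
  refine average_le_average (fun s => ?_) _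
  have h1 := abs_coupledIncrement_le Q₁ Q₂ h.le n k ω s
  have h2 : |coupledIncrement g Q₁ Q₂ n k ω s| ≤
      c ^ k * A * (∑ j ∈ Finset.range k, average Ψ (ω j)) * c ^ (n - k + 1) +
        c ^ k * (backwardConst A c (n - k) * Ψ s) := by
    refine (abs_mul_sub_mul_le (P := c ^ (n - k + 1)) (B := c ^ k) ?_ ?_).trans ?_
    · exact abs_le_of_mem_Icc (backwardLikelihood_mem_Icc Q₁ h.le _ _ _)
    · exact abs_le_of_mem_Icc (likelihoodEstimate_mem_Icc h.le k _)
    · gcongr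
      · exact h.abs_likelihoodEstimate_sub_le k ω
      · exact h.abs_backwardLikelihood_sub_le hM₁ hM₂ (n - k) k s.1 s.2
  rw [← sq_abs, sq]
  refine mul_le_mul h1 (h2.trans_eq ?_) (abs_nonneg _) (by positivity)
  ring

lemma weight_le [NeZero N] (h : IsCouplingControl g M A c Ψ) (k : ℕ) (x : Fin N → E)
    (i : Fin N) : weight (g k) x i ≤ c ^ 2 * (1 / (N : ℝ)) := by
  have hc : 0 < c := zero_lt_one.trans_le h.one_le
  have hN : (0 : ℝ) < N := Nat.cast_pos.2 (NeZero.pos N)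
  have hS : (N : ℝ) * c⁻¹ ≤ ∑ j, g k (x j) := by
    simpa using Finset.card_nsmul_le_sum Finset.univ (fun j => g k (x j)) c⁻¹
      fun j _ => h.inv_le k (x j)
  unfold weight
  refine (div_le_div₀ hc.le (h.le k (x i)) (by positivity) hS).trans_eq ?_
  field_simp

lemma sum_abs_weight_sub_le [NeZero N] (h : IsCouplingControl g M A c Ψ) (k : ℕ)
    (v : Fin N → E × E) :
    ∑ i, |weight (g k) (fun s => (v s).1) i - weight (g k) (fun s => (v s).2) i| ≤
      2 * c * A * average Ψ v := by
  have hc : 0 < c := zero_lt_one.trans_le h.one_le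
  have hN : (0 : ℝ) < N := Nat.cast_pos.2 (NeZero.pos N)
  have : Nonempty (Fin N) := ⟨⟨0, NeZero.pos N⟩⟩
  set S₁ := ∑ j, g k (v j).1 with hS₁
  set S₂ := ∑ j, g k (v j).2 with hS₂
  have p₁ : 0 < S₁ := Finset.sum_pos (fun _ _ => (g k).pos _) Finset.univ_nonempty
  have p₂ : 0 < S₂ := Finset.sum_pos (fun _ _ => (g k).pos _) Finset.univ_nonempty
  have hS : (N : ℝ) * c⁻¹ ≤ S₁ := by
    simpa using Finset.card_nsmul_le_sum Finset.univ (fun j => g k (v j).1) c⁻¹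
      fun j _ => h.inv_le k (v j).1
  have hsum : ∑ i, |g k (v i).1 - g k (v i).2| ≤ N * (A * average Ψ v) := by
    have e : (N : ℝ) * (A * average Ψ v) = ∑ i, A * Ψ (v i) := by
      rw [average, ← Finset.mul_sum]; field_simp
    rw [e]
    exact Finset.sum_le_sum fun i _ => h.abs_sub_le k _ _
  have hdiff : |S₂ - S₁| ≤ ∑ i, |g k (v i).1 - g k (v i).2| := by
    rw [abs_sub_comm, hS₁, hS₂, ← Finset.sum_sub_distrib]
    exact Finset.abs_sum_le_sum_abs _ _
  have hterm : ∀ i, |weight (g k) (fun s => (v s).1) i - weight (g k) (fun s => (v s).2) i| ≤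
      |g k (v i).1 - g k (v i).2| / S₁ + weight (g k) (fun s => (v s).2) i * (|S₂ - S₁| / S₁) := by
    intro i
    -- Change the numerator first, then the normalisation. After summation each part is at most `∑
    -- |g₁ - g₂| / S₁` with `S₁ ≥ N / c`, whence the factor `2 * c`.
    have e : weight (g k) (fun s => (v s).1) i - weight (g k) (fun s => (v s).2) i =
        (g k (v i).1 - g k (v i).2) / S₁ +
          weight (g k) (fun s => (v s).2) i * ((S₂ - S₁) / S₁) := by
      simp only [weight, ← hS₁, ← hS₂]
      field_simp
      ring
    rw [e]
    refine (abs_add_le _ _).trans_eq ?_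
    rw [abs_div, abs_mul, abs_div, abs_of_pos p₁, abs_of_nonneg (weight_nonneg _ _ _)]
  calc _ ≤ ∑ i, (|g k (v i).1 - g k (v i).2| / S₁ +
        weight (g k) (fun s => (v s).2) i * (|S₂ - S₁| / S₁)) :=
        Finset.sum_le_sum fun i _ => hterm i
    _ = (∑ i, |g k (v i).1 - g k (v i).2| + |S₂ - S₁|) / S₁ := by
        rw [Finset.sum_add_distrib, ← Finset.sum_mul, sum_weight _ _ (NeZero.pos N),
          ← Finset.sum_div, one_mul, add_div]
    _ ≤ (N * (A * average Ψ v) + N * (A * average Ψ v)) / (N * c⁻¹) := by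
        have h1 := h.average_nonneg v
        have h2 := h.nonneg
        gcongr
        exact hdiff.trans hsum
    _ = _ := by field_simp; ring

/-- The two terms of `selectionConst` are the two branches of the resampling. With a common
ancestor, weights are at most `c ^ 2 / N` and `M` costs a factor `A`; with separate ancestors only
`Ψ ≤ 1` is used, and `1 - α` is at most the `ℓ¹` distance of the weights. -/
lemma integral_coupledSelectMove_le [NeZero N] [IsMarkovKernel M]
    (h : IsCouplingControl g M A c Ψ) (k : ℕ) (v : Fin N → E × E) :
    ∫ z, Ψ z ∂(coupledSelectMove (g k) M N v) ≤ selectionConst A c * average Ψ v := by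
  have hN : (0 : ℝ) < N := Nat.cast_pos.2 (NeZero.pos N)
  rw [integral_coupledSelectMove (g k) M (NeZero.pos N) v h.measurable
    fun z => abs_le_of_mem_Icc (h.mem_Icc z)]
  have hw := sum_abs_weight_sub_le h k v
  have hwle := h.weight_le k (fun s => (v s).1)
  set w₁ := weight (g k) fun s => (v s).1 with hw₁
  set w₂ := weight (g k) fun s => (v s).2 with hw₂
  have n₁ : ∀ i, 0 ≤ w₁ i := weight_nonneg _ _
  have n₂ : ∀ i, 0 ≤ w₂ i := weight_nonneg _ _
  have s₁ : ∑ i, w₁ i = 1 := sum_weight _ _ (NeZero.pos N)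
  have s₂ : ∑ i, w₂ i = 1 := sum_weight _ _ (NeZero.pos N)
  let m : Fin N → ℝ := fun s => min (w₁ s) (w₂ s)
  have hm : ∀ s, 0 ≤ m s := fun s => le_min (n₁ s) (n₂ s)
  set α := ∑ s, m s with hα
  have hα0 : 0 ≤ α := Finset.sum_nonneg fun s _ => hm s
  have hα1 : 1 - α ≤ 2 * c * A * average Ψ v := by
    refine le_trans ?_ hw
    rw [hα, ← s₁, ← Finset.sum_sub_distrib]
    refine Finset.sum_le_sum fun i _ => ?_
    rcases le_total (w₁ i) (w₂ i) with hle | hle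
    · simp [m, hle]
    · simp only [m, min_eq_right hle]; exact le_abs_self _
  have hα2 : 0 ≤ 1 - α := by
    rw [hα, ← s₁, ← Finset.sum_sub_distrib]
    exact Finset.sum_nonneg fun i _ => sub_nonneg.2 (min_le_left _ _)
  let a : Fin N → ℝ := fun i => (w₁ i - m i) / ∑ s, (w₁ s - m s)
  let b : Fin N → ℝ := fun i => (w₂ i - m i) / ∑ s, (w₂ s - m s)
  have e₁ : ∀ s, 0 ≤ w₁ s - m s := fun s => sub_nonneg.2 (min_le_left _ _)
  have e₂ : ∀ s, 0 ≤ w₂ s - m s := fun s => sub_nonneg.2 (min_le_right _ _)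
  have ha : ∀ i, 0 ≤ a i := fun i => div_nonneg (e₁ i) (Finset.sum_nonneg fun s _ => e₁ s)
  have hb : ∀ i, 0 ≤ b i := fun i => div_nonneg (e₂ i) (Finset.sum_nonneg fun s _ => e₂ s)
  -- Only an inequality: the sum is zero when there is no residual mass.
  have hsa : ∑ i, a i ≤ 1 := by
    rw [← Finset.sum_div]; exact div_self_le_one _
  have hsb : ∑ i, b i ≤ 1 := by
    rw [← Finset.sum_div]; exact div_self_le_one _
  let I : Fin N → Fin N → ℝ := fun i j => ∫ z, Ψ z ∂(M ((v i).1, (v j).2))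
  have hI : ∀ i j, I i j ∈ Set.Icc 0 1 := fun i j => integral_mem_Icc h.mem_Icc
  have hbound : ∀ i j, coupledResampling w₁ w₂ i j * I i j ≤
      (if i = j then m i * I i j else 0) + (1 - α) * (a i * b j) := by
    intro i j
    have h1 : coupledResampling w₁ w₂ i j =
        α * (if i = j then m i / α else 0) + (1 - α) * (a i * b j) := rfl
    rw [h1, add_mul]
    refine add_le_add ?_ ?_
    · split_ifs with hij
      · refine mul_le_mul_of_nonneg_right ?_ (hI i j).1
        rcases eq_or_ne α 0 with h0 | h0
        · simpa [h0] using hm i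
        · exact (mul_div_cancel₀ _ h0).le
      · simp
    · exact mul_le_of_le_one_right (mul_nonneg hα2 (mul_nonneg (ha i) (hb j))) (hI i j).2
  calc _ ≤ ∑ i, ∑ j, ((if i = j then m i * I i j else 0) + (1 - α) * (a i * b j)) :=
        Finset.sum_le_sum fun i _ => Finset.sum_le_sum fun j _ => hbound i j
    _ = ∑ i, m i * I i i + (1 - α) * ((∑ i, a i) * ∑ j, b j) := by
        simp only [Finset.sum_add_distrib, Finset.sum_ite_eq, Finset.mem_univ, if_true,
          ← Finset.mul_sum, ← Finset.sum_mul]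
    _ ≤ ∑ i, c ^ 2 * (1 / (N : ℝ)) * (A * Ψ (v i)) + (1 - α) * 1 := by
        refine add_le_add (Finset.sum_le_sum fun i _ => ?_) (mul_le_mul_of_nonneg_left ?_ hα2)
        · exact mul_le_mul ((min_le_left _ _).trans (hwle i)) (h.integral_le (v i)) (hI i i).1
            (by positivity)
        · exact mul_le_one₀ hsa (Finset.sum_nonneg fun i _ => hb i) hsb
    _ = c ^ 2 * A * average Ψ v + (1 - α) := by
        simp only [← Finset.mul_sum, average]; ring
    _ ≤ _ := by
        rw [selectionConst, add_mul]
        gcongr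

/-- The factor `A` comes from the initial draw from `M (x₀, x₀)`, each power of `selectionConst`
from one selection and mutation. -/
lemma integral_average_le [NeZero N] [IsMarkovKernel M] (h : IsCouplingControl g M A c Ψ)
    (x₀ : E) (k : ℕ) :
    ∫ ω, average Ψ (ω k) ∂(coupledFilterLaw g M x₀ N) ≤
      selectionConst A c ^ k * A * Ψ (x₀, x₀) := by
  have hc : 0 ≤ c := zero_le_one.trans h.one_le
  have hb := fun z => abs_le_of_mem_Icc (h.mem_Icc z)
  have hR : 0 ≤ selectionConst A c := by
    have := h.nonneg
    unfold selectionConst; positivity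
  change ∫ ω, average Ψ (ω k)
    ∂(particleLaw (M (x₀, x₀)) fun k => coupledSelectMove (g k) M N) ≤ _
  induction k with
  | zero =>
    rw [integral_particleLaw_average_zero h.measurable hb]
    simpa using h.integral_le (x₀, x₀)
  | succ k ih =>
    rw [integral_particleLaw_average_succ k (U := fun _ => Ψ) (h.measurable.comp measurable_snd)
      (fun _ => hb) fun _ _ _ _ => rfl]
    calc _ ≤ ∫ ω, selectionConst A c * average Ψ (ω k)
          ∂(particleLaw (M (x₀, x₀)) fun k => coupledSelectMove (g k) M N) := by
          refine integral_mono_of_nonneg (ae_of_all _ fun ω => ?_) (Integrable.const_mul ?_ _)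
            (ae_of_all _ fun ω => h.integral_coupledSelectMove_le k (ω k))
          · exact integral_nonneg fun z => (h.mem_Icc z).1
          · exact integrable_of_abs_le (measurable_average_uncurry
              (F := fun _ : ℕ → Fin N → E × E => Ψ) (h.measurable.comp measurable_snd)
              (measurable_pi_apply k)) fun ω => abs_average_le_of_le hb (ω k)
      _ ≤ _ := by
          rw [integral_const_mul]
          refine (mul_le_mul_of_nonneg_left ih hR).trans_eq ?_
          ring

/-- Mean square error of a coupled particle filter for the difference of two marginal
likelihoods. -/
theorem coupledFilterLaw_sq_le [NeZero N] (h : IsCouplingControl g M A c Ψ)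
    {Q₁ Q₂ : Kernel E E} [IsMarkovKernel Q₁] [IsMarkovKernel Q₂] [IsMarkovKernel M]
    (hM₁ : ∀ x x', (M (x, x')).map Prod.fst = Q₁ x)
    (hM₂ : ∀ x x', (M (x, x')).map Prod.snd = Q₂ x') (x₀ : E) (n : ℕ) :
    ∫ ω : ℕ → Fin N → E × E, (likelihoodEstimate g (n + 1) (fun k i => (ω k i).1) -
        likelihoodEstimate g (n + 1) (fun k i => (ω k i).2) -
        (marginalLikelihood Q₁ (n + 1) g x₀ - marginalLikelihood Q₂ (n + 1) g x₀)) ^ 2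
        ∂(coupledFilterLaw g M x₀ N) ≤
      filterConst A c n * Ψ (x₀, x₀) / N := by
  have hc : 0 ≤ c := zero_le_one.trans h.one_le
  have hA := h.nonneg
  have : IsProbabilityMeasure (coupledFilterLaw g M x₀ N) :=
    inferInstanceAs (IsProbabilityMeasure
      (particleLaw (M (x₀, x₀)) fun k => coupledSelectMove (g k) M N))
  refine (coupledFilterLaw_mean_sq g hM₁ hM₂ x₀ h.le n).2.trans ?_
  rw [one_div, div_eq_inv_mul]
  refine mul_le_mul_of_nonneg_left ?_ (by positivity)
  rw [filterConst, Finset.sum_mul]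
  refine Finset.sum_le_sum fun k _ => ?_
  have hint : ∀ k, Integrable (fun ω : ℕ → Fin N → E × E => average Ψ (ω k))
      (coupledFilterLaw g M x₀ N) := fun k =>
    integrable_of_abs_le (measurable_average_uncurry
      (F := fun _ : ℕ → Fin N → E × E => Ψ) (h.measurable.comp measurable_snd)
      (measurable_pi_apply k))
      fun ω => abs_average_le_of_le (fun z => abs_le_of_mem_Icc (h.mem_Icc z)) (ω k)
  have hi := h.integral_average_le (N := N) x₀
  have hD := backwardConst_nonneg hA hc (n - k)
  calc _ ≤ ∫ ω : ℕ → Fin N → E × E, c ^ k * c ^ (n - k + 1) *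
        (c ^ k * c ^ (n - k + 1) * A * (∑ j ∈ Finset.range k, average Ψ (ω j)) +
          c ^ k * backwardConst A c (n - k) * average Ψ (ω k)) ∂(coupledFilterLaw g M x₀ N) := by
        refine integral_mono_of_nonneg (ae_of_all _ fun ω => ?_) ?_ (ae_of_all _ fun ω =>
          h.average_sq_coupledIncrement_le hM₁ hM₂ n k ω)
        · exact mul_nonneg (by positivity) (Finset.sum_nonneg fun _ _ => sq_nonneg _)
        · exact (((integrable_finsetSum _ fun j _ => hint j).const_mul _).add
            ((hint k).const_mul _)).const_mul _
    _ = c ^ k * c ^ (n - k + 1) * (c ^ k * c ^ (n - k + 1) * A *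
          (∑ j ∈ Finset.range k, ∫ ω, average Ψ (ω j) ∂(coupledFilterLaw g M x₀ N)) +
          c ^ k * backwardConst A c (n - k) *
            ∫ ω, average Ψ (ω k) ∂(coupledFilterLaw g M x₀ N)) := by
        rw [integral_const_mul, integral_add
          ((integrable_finsetSum _ fun j _ => hint j).const_mul _) ((hint k).const_mul _),
          integral_const_mul, integral_const_mul, integral_finsetSum _ fun j _ => hint j]
    _ ≤ c ^ k * c ^ (n - k + 1) * (c ^ k * c ^ (n - k + 1) * A *
          (∑ j ∈ Finset.range k, selectionConst A c ^ j * A * Ψ (x₀, x₀)) +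
          c ^ k * backwardConst A c (n - k) * (selectionConst A c ^ k * A * Ψ (x₀, x₀))) := by
        gcongr with j hj
        · exact hi j
        · exact hi k
    _ = _ := by
        rw [← Finset.sum_mul]; ring

end IsCouplingControl

end Coupled

/-! ### The multilevel estimator -/

section MultilevelBound

variable {E : Type*} [MeasurableSpace E]

instance (g : ℕ → Potential E) (Q : Kernel E E) [IsMarkovKernel Q] (x₀ : E) (N : ℕ) [NeZero N] :
    IsProbabilityMeasure (filterLaw g Q x₀ N) :=
  inferInstanceAs (IsProbabilityMeasure (particleLaw (Q x₀) fun k => selectMove (g k) Q N))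

instance (g : ℕ → Potential E) (M : Kernel (E × E) (E × E)) [IsMarkovKernel M] (x₀ : E) (N : ℕ)
    [NeZero N] : IsProbabilityMeasure (coupledFilterLaw g M x₀ N) :=
  inferInstanceAs (IsProbabilityMeasure
    (particleLaw (M (x₀, x₀)) fun k => coupledSelectMove (g k) M N))

instance (g : ℕ → Potential E) (Q : ℕ → Kernel E E) [∀ l, IsMarkovKernel (Q l)]
    (M : ℕ → Kernel (E × E) (E × E)) [∀ l, IsMarkovKernel (M l)] (x₀ : E) (L : ℕ) (N : ℕ → ℕ+) :
    IsProbabilityMeasure (multilevelLaw g Q M x₀ L N) := by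
  unfold multilevelLaw; infer_instance

lemma integral_sq_sub_eq_variance {Ω : Type*} [MeasurableSpace Ω] {μ : Measure Ω}
    {X : Ω → ℝ} {p : ℝ} (hX : AEMeasurable X μ) (hp : ∫ ω, X ω ∂μ = p) :
    ∫ ω, (X ω - p) ^ 2 ∂μ = Var[X; μ] := by
  rw [variance_eq_integral hX, hp]

lemma memLp_likelihoodEstimate {Ω : Type*} [MeasurableSpace Ω] {μ : Measure Ω} [IsFiniteMeasure μ]
    {g : ℕ → Potential E} {c : ℝ} (hg : ∀ k x, g k x ≤ c) (n : ℕ) {N : ℕ} [NeZero N]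
    {X : Ω → ℕ → Fin N → E} (hX : Measurable X) :
    MemLp (fun ω => likelihoodEstimate g n (X ω)) 2 μ :=
  MemLp.of_bound ((measurable_likelihoodEstimate g n).comp hX).aestronglyMeasurable (c ^ n)
    (ae_of_all _ fun ω => abs_le_of_mem_Icc (likelihoodEstimate_mem_Icc hg n (X ω)))

/-- The multilevel estimator is square integrable and unbiased, and the mean square errors of the
levels add up. -/
theorem multilevelLaw_mean_sq {g : ℕ → Potential E} {Q : ℕ → Kernel E E}
    [∀ l, IsMarkovKernel (Q l)] {M : ℕ → Kernel (E × E) (E × E)} [∀ l, IsMarkovKernel (M l)]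
    (hM : IsMultilevelCoupling Q M) {c : ℝ} (hg : ∀ k x, g k x ≤ c) (x₀ : E) (n L : ℕ)
    (N : ℕ → ℕ+) {B : ℕ → ℝ}
    (hB₀ : ∫ ω, (likelihoodEstimate g (n + 1) ω - marginalLikelihood (Q 0) (n + 1) g x₀) ^ 2
      ∂(filterLaw g (Q 0) x₀ (N 0)) ≤ B 0)
    (hB : ∀ l, ∫ ω : ℕ → Fin (N (l + 1)) → E × E,
      (likelihoodEstimate g (n + 1) (fun k i => (ω k i).1) -
        likelihoodEstimate g (n + 1) (fun k i => (ω k i).2) -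
        (marginalLikelihood (Q (l + 1)) (n + 1) g x₀ - marginalLikelihood (Q l) (n + 1) g x₀)) ^ 2
        ∂(coupledFilterLaw g (M (l + 1)) x₀ (N (l + 1))) ≤ B (l + 1)) :
    MemLp (multilevelEstimate g (n + 1) L N) 2 (multilevelLaw g Q M x₀ L N) ∧
    ∫ ω, multilevelEstimate g (n + 1) L N ω ∂(multilevelLaw g Q M x₀ L N) =
      marginalLikelihood (Q L) (n + 1) g x₀ ∧
    ∫ ω, (multilevelEstimate g (n + 1) L N ω - marginalLikelihood (Q L) (n + 1) g x₀) ^ 2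
      ∂(multilevelLaw g Q M x₀ L N) ≤ ∑ l ∈ Finset.range (L + 1), B l := by
  let X : (ℕ → Fin (N 0) → E) → ℝ := fun ω => likelihoodEstimate g (n + 1) ω
  let Y : (l : Fin L) → (ℕ → Fin (N (l + 1)) → E × E) → ℝ := fun l ω =>
    likelihoodEstimate g (n + 1) (fun k i => (ω k i).1) -
      likelihoodEstimate g (n + 1) (fun k i => (ω k i).2)
  let μ := filterLaw g (Q 0) x₀ (N 0)
  let ν : (l : Fin L) → Measure (ℕ → Fin (N (l + 1)) → E × E) := fun l =>
    coupledFilterLaw g (M (l + 1)) x₀ (N (l + 1))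
  have hX : MemLp X 2 μ := memLp_likelihoodEstimate hg (n + 1) measurable_id
  have hY : ∀ l, MemLp (Y l) 2 (ν l) := fun l =>
    (memLp_likelihoodEstimate hg (n + 1) (by fun_prop)).sub
      (memLp_likelihoodEstimate hg (n + 1) (by fun_prop))
  have hYe : ∀ l, MemLp (fun ω : (l : Fin L) → (ℕ → Fin (N (l + 1)) → E × E) => Y l (ω l)) 2
      (Measure.pi ν) := fun l => (hY l).comp_measurePreserving (measurePreserving_eval ν l)
  have hS : MemLp (∑ l, fun ω : (l : Fin L) → (ℕ → Fin (N (l + 1)) → E × E) => Y l (ω l)) 2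
      (Measure.pi ν) := memLp_finsetSum' _ fun l _ => hYe l
  have hest : multilevelEstimate g (n + 1) L N = fun ω => X ω.1 +
      (∑ l, fun ω : (l : Fin L) → (ℕ → Fin (N (l + 1)) → E × E) => Y l (ω l)) ω.2 := by
    ext ω
    rw [Finset.sum_apply]
    rfl
  have hlaw : multilevelLaw g Q M x₀ L N = μ.prod (Measure.pi ν) := rfl
  have hmX : ∫ ω, X ω ∂μ = marginalLikelihood (Q 0) (n + 1) g x₀ :=
    (filterLaw_mean_sq g (Q 0) x₀ hg n).1
  have hmY : ∀ l : Fin L, ∫ ω, Y l ω ∂(ν l) = marginalLikelihood (Q (l + 1)) (n + 1) g x₀ -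
      marginalLikelihood (Q l) (n + 1) g x₀ := fun l =>
    (coupledFilterLaw_mean_sq g (fun x x' => (hM l x x').1) (fun x x' => (hM l x x').2) x₀ hg n).1
  have hmem : MemLp (multilevelEstimate g (n + 1) L N) 2 (multilevelLaw g Q M x₀ L N) := by
    rw [hest, hlaw]
    exact (hX.comp_fst _).add (hS.comp_snd _)
  have hmean : ∫ ω, multilevelEstimate g (n + 1) L N ω ∂(multilevelLaw g Q M x₀ L N) =
      marginalLikelihood (Q L) (n + 1) g x₀ := by
    rw [hest, hlaw, integral_add ((hX.comp_fst _).integrable one_le_two)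
      ((hS.comp_snd _).integrable one_le_two), integral_fun_fst, integral_fun_snd]
    simp only [Finset.sum_apply]
    rw [integral_finsetSum _ fun l _ => (hYe l).integrable one_le_two]
    simp_rw [fun l => integral_comp_eval (μ := ν) (hY l).aestronglyMeasurable, hmX, hmY]
    -- The means of the level differences telescope against the mean at level `0`.
    rw [Fin.sum_univ_eq_sum_range (fun l => marginalLikelihood (Q (l + 1)) (n + 1) g x₀ -
      marginalLikelihood (Q l) (n + 1) g x₀), Finset.sum_range_sub
      fun l => marginalLikelihood (Q l) (n + 1) g x₀]
    simp
  refine ⟨hmem, hmean, ?_⟩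
  -- Unbiasedness turns the error into a variance, which is additive over the independent levels.
  rw [integral_sq_sub_eq_variance hmem.aemeasurable hmean, hest, hlaw, variance_add_prod hX hS,
    variance_sum_pi hY, Finset.sum_range_succ', add_comm,
    ← Fin.sum_univ_eq_sum_range fun l => B (l + 1)]
  refine add_le_add (Finset.sum_le_sum fun l _ => ?_) ?_
  · rw [← integral_sq_sub_eq_variance (hY l).aemeasurable (hmY l)]
    exact hB l
  · rw [← integral_sq_sub_eq_variance hX.aemeasurable hmX]
    exact hB₀

lemma PotentialAssumption.exists_bound {X : Type*} [PseudoMetricSpace X] [MeasurableSpace X]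
    [OpensMeasurableSpace X] {g : ℕ → X → ℝ} (hG : PotentialAssumption g) :
    ∃ c : ℝ, 1 < c ∧ ∃ C : ℝ, 0 < C ∧ ∀ k, (∀ x, c⁻¹ ≤ hG.potential k x) ∧
      (∀ x, hG.potential k x ≤ c) ∧
      ∀ x x', |hG.potential k x - hG.potential k x'| ≤ C * dist x x' := by
  obtain ⟨c, hc, C, hC, h⟩ := id hG
  exact ⟨c, hc, C, hC, fun k => ⟨fun x => ((h k).1 x).1.le, fun x => ((h k).1 x).2.le, (h k).2⟩⟩

/-- The constant control: every pair of components is at distance at most one. -/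
lemma isCouplingControl_one {g : ℕ → Potential E} {c : ℝ} (hc : 1 ≤ c)
    (h₁ : ∀ k x, c⁻¹ ≤ g k x) (h₂ : ∀ k x, g k x ≤ c) (M : Kernel (E × E) (E × E))
    [IsMarkovKernel M] : IsCouplingControl g M c c fun _ => 1 where
  one_le := hc
  nonneg := zero_le_one.trans hc
  inv_le := h₁
  le := h₂
  measurable := measurable_const
  mem_Icc _ := by simp
  abs_sub_le k x x' := by
    have := (g k).pos x
    have := (g k).pos x'
    rw [abs_le]
    constructor <;> linarith [h₂ k x, h₂ k x']
  integral_le _ := by simpa using hc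

/-- Constant in the mean square error bound for a particle filter. -/
noncomputable def singleConst (c : ℝ) (n : ℕ) : ℝ :=
  ∑ k ∈ Finset.range (n + 1), (c ^ k * c ^ (n - k + 1)) ^ 2

lemma filterLaw_sq_le (g : ℕ → Potential E) (Q : Kernel E E) [IsMarkovKernel Q] (x₀ : E)
    {c : ℝ} (hg : ∀ k x, g k x ≤ c) (n : ℕ) (N : ℕ) [NeZero N] :
    ∫ ω, (likelihoodEstimate g (n + 1) ω - marginalLikelihood Q (n + 1) g x₀) ^ 2
        ∂(filterLaw g Q x₀ N) ≤ singleConst c n / N := by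
  refine (filterLaw_mean_sq g Q x₀ hg n).2.trans_eq ?_
  rw [singleConst, one_div, div_eq_inv_mul]

/-- Mean square error of the multilevel estimator in terms of controls `Ψ l` for the couplings. -/
theorem multilevelLaw_of_control {g : ℕ → Potential E} {Q : ℕ → Kernel E E}
    [∀ l, IsMarkovKernel (Q l)] {M : ℕ → Kernel (E × E) (E × E)} [∀ l, IsMarkovKernel (M l)]
    (hM : IsMultilevelCoupling Q M) {A c : ℝ} {Ψ : ℕ → E × E → ℝ}
    (hΨ : ∀ l, IsCouplingControl g (M (l + 1)) A c (Ψ (l + 1))) (x₀ : E) (n L : ℕ) (N : ℕ → ℕ+)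
    {B : ℕ → ℝ} (hB₀ : singleConst c n ≤ B 0)
    (hB : ∀ l, filterConst A c n * Ψ (l + 1) (x₀, x₀) ≤ B (l + 1)) :
    MemLp (multilevelEstimate g (n + 1) L N) 2 (multilevelLaw g Q M x₀ L N) ∧
    ∫ ω, multilevelEstimate g (n + 1) L N ω ∂(multilevelLaw g Q M x₀ L N) =
      marginalLikelihood (Q L) (n + 1) g x₀ ∧
    ∫ ω, (multilevelEstimate g (n + 1) L N ω - marginalLikelihood (Q L) (n + 1) g x₀) ^ 2
      ∂(multilevelLaw g Q M x₀ L N) ≤ ∑ l ∈ Finset.range (L + 1), B l / (N l : ℝ) := by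
  have hg := (hΨ 0).le
  refine multilevelLaw_mean_sq hM hg x₀ n L N (B := fun l => B l / (N l : ℝ)) ?_ fun l => ?_
  · refine (filterLaw_sq_le g (Q 0) x₀ hg n (N 0)).trans ?_
    gcongr
  · refine ((hΨ l).coupledFilterLaw_sq_le (fun x x' => (hM l x x').1)
      (fun x x' => (hM l x x').2) x₀ n).trans ?_
    gcongr
    exact hB l

end MultilevelBound

/-! ### Allocation of the sample sizes, and cost -/

section Cost

lemma stepSize_pos (l : ℕ) : 0 < stepSize l := by unfold stepSize; positivity

lemma stepSize_le_one (l : ℕ) : stepSize l ≤ 1 := inv_le_one_of_one_le₀ (one_le_pow₀ one_le_two)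

lemma two_mul_stepSize_succ (l : ℕ) : 2 * stepSize (l + 1) = stepSize l := by
  unfold stepSize; rw [pow_succ]; field_simp

/-- The normalisation `∑_{k ≤ L} h_k^{-1/4}` of the allocation. -/
noncomputable def allocationSum (L : ℕ) : ℝ :=
  ∑ k ∈ Finset.range (L + 1), stepSize k ^ (-(1 / 4) : ℝ)

lemma allocationSum_pos (L : ℕ) : 0 < allocationSum L :=
  Finset.sum_pos (fun k _ => Real.rpow_pos_of_pos (stepSize_pos k) _) (by simp)

lemma le_sampleSizes (ε : ℝ) (l : ℕ) :
    ε ^ (-2 : ℝ) * stepSize l ^ (3 / 4 : ℝ) * allocationSum (finestLevel ε) ≤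
      (sampleSizes ε l : ℝ) :=
  (Nat.le_ceil _).trans (Nat.cast_le.2 (le_max_right _ _))

lemma sampleSizes_le {ε : ℝ} (hε : 0 < ε) (l : ℕ) :
    (sampleSizes ε l : ℝ) ≤
      1 + ε ^ (-2 : ℝ) * stepSize l ^ (3 / 4 : ℝ) * allocationSum (finestLevel ε) := by
  have h0 : 0 ≤ ε ^ (-2 : ℝ) * stepSize l ^ (3 / 4 : ℝ) * allocationSum (finestLevel ε) :=
    mul_nonneg (mul_nonneg (Real.rpow_nonneg hε.le _) (Real.rpow_nonneg (stepSize_pos l).le _))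
      (allocationSum_pos _).le
  have h1 : (sampleSizes ε l : ℝ) = max 1 (⌈ε ^ (-2 : ℝ) * stepSize l ^ (3 / 4 : ℝ) *
      allocationSum (finestLevel ε)⌉₊ : ℝ) := by
    rw [← Nat.cast_one, ← Nat.cast_max]; rfl
  rw [h1]
  refine max_le (by linarith) ?_
  linarith [Nat.ceil_lt_add_one h0]

lemma stepSize_finestLevel_le {ε : ℝ} (hε : 0 < ε) : stepSize (finestLevel ε) ≤ ε := by
  have h : Real.logb 2 ε⁻¹ ≤ (finestLevel ε : ℝ) := Nat.le_ceil _
  rw [Real.logb_le_iff_le_rpow one_lt_two (inv_pos.2 hε), Real.rpow_natCast] at h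
  exact inv_le_of_inv_le₀ hε h

lemma two_pow_finestLevel_le {ε : ℝ} (hε : 0 < ε) (hε1 : ε < 1) :
    (2 : ℝ) ^ finestLevel ε ≤ 2 * ε⁻¹ := by
  have h0 : 0 < Real.logb 2 ε⁻¹ := Real.logb_pos one_lt_two ((one_lt_inv₀ hε).2 hε1)
  have h : (finestLevel ε : ℝ) ≤ Real.logb 2 ε⁻¹ + 1 := (Nat.ceil_lt_add_one h0.le).le
  calc (2 : ℝ) ^ finestLevel ε = (2 : ℝ) ^ (finestLevel ε : ℝ) := (Real.rpow_natCast _ _).symm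
    _ ≤ (2 : ℝ) ^ (Real.logb 2 ε⁻¹ + 1) := Real.rpow_le_rpow_of_exponent_le one_le_two h
    _ = _ := by
      rw [Real.rpow_add two_pos, Real.rpow_logb two_pos (by norm_num) (inv_pos.2 hε),
        Real.rpow_one, mul_comm]

/-- The lower bound on `N_l` makes the summand at most `ε² K⁻¹ h_l^{-1/4}`, and `K` is the sum of
the `h_l^{-1/4}`. -/
lemma sum_sqrt_stepSize_div_sampleSizes_le {ε : ℝ} (hε : 0 < ε) :
    ∑ l ∈ Finset.range (finestLevel ε + 1),
      stepSize l ^ (1 / 2 : ℝ) / (sampleSizes ε l : ℝ) ≤ ε ^ 2 := by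
  have hK := allocationSum_pos (finestLevel ε)
  set K := allocationSum (finestLevel ε) with hKdef
  have hterm : ∀ l, stepSize l ^ (1 / 2 : ℝ) / (sampleSizes ε l : ℝ) ≤
      ε ^ 2 / K * stepSize l ^ (-(1 / 4) : ℝ) := by
    intro l
    have hh := stepSize_pos l
    have h2 : 0 < stepSize l ^ (3 / 4 : ℝ) := Real.rpow_pos_of_pos hh _
    have hε2 : 0 < ε ^ (-2 : ℝ) := Real.rpow_pos_of_pos hε _
    have e : stepSize l ^ (1 / 2 : ℝ) =
        stepSize l ^ (3 / 4 : ℝ) * stepSize l ^ (-(1 / 4) : ℝ) := by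
      rw [← Real.rpow_add hh]; norm_num
    calc stepSize l ^ (1 / 2 : ℝ) / (sampleSizes ε l : ℝ)
        ≤ stepSize l ^ (1 / 2 : ℝ) / (ε ^ (-2 : ℝ) * stepSize l ^ (3 / 4 : ℝ) * K) :=
          div_le_div_of_nonneg_left (Real.rpow_nonneg hh.le _) (by positivity)
            (le_sampleSizes ε l)
      _ = _ := by
          rw [e, Real.rpow_neg hε.le, Real.rpow_two]
          field_simp
  calc _ ≤ ∑ l ∈ Finset.range (finestLevel ε + 1),
        ε ^ 2 / K * stepSize l ^ (-(1 / 4) : ℝ) := Finset.sum_le_sum fun l _ => hterm l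
    _ = ε ^ 2 / K * K := by rw [← Finset.mul_sum]; rfl
    _ = ε ^ 2 := by field_simp

lemma stepSize_rpow_neg_quarter (k : ℕ) :
    stepSize k ^ (-(1 / 4) : ℝ) = ((2 : ℝ) ^ (1 / 4 : ℝ)) ^ k := by
  rw [stepSize, Real.rpow_neg (by positivity), Real.inv_rpow (by positivity), inv_inv,
    ← Real.rpow_natCast, ← Real.rpow_natCast, ← Real.rpow_mul zero_le_two,
    ← Real.rpow_mul zero_le_two, mul_comm]

lemma one_lt_two_rpow_quarter : 1 < (2 : ℝ) ^ (1 / 4 : ℝ) :=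
  Real.one_lt_rpow one_lt_two (by norm_num)

/-- A geometric sum of ratio `q = 2^{1/4}`, dominated by its last term, with `2^L ≤ 2 / ε`. -/
lemma allocationSum_sq_le {ε : ℝ} (hε : 0 < ε) (hε1 : ε < 1) :
    allocationSum (finestLevel ε) ^ 2 ≤
      2 * 2 / ((2 : ℝ) ^ (1 / 4 : ℝ) - 1) ^ 2 * ε ^ (-(1 / 2) : ℝ) := by
  have hq := one_lt_two_rpow_quarter
  set q := (2 : ℝ) ^ (1 / 4 : ℝ) with hqdef
  set L := finestLevel ε with hL
  have hq4 : q ^ 4 = 2 := by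
    rw [hqdef, ← Real.rpow_natCast, ← Real.rpow_mul zero_le_two]; norm_num
  have hsum : allocationSum L ≤ q ^ (L + 1) / (q - 1) := by
    have : allocationSum L = ∑ k ∈ Finset.range (L + 1), q ^ k :=
      Finset.sum_congr rfl fun k _ => stepSize_rpow_neg_quarter k
    rw [this, geom_sum_eq hq.ne']
    gcongr
    · linarith
  have hpow : (q ^ (L + 1)) ^ 2 ≤ 2 * 2 * ε ^ (-(1 / 2) : ℝ) := by
    have h0 : 0 ≤ ε ^ (-(1 / 2) : ℝ) := Real.rpow_nonneg hε.le _
    -- Squaring once more removes the fractional powers: `q ^ (4 (L + 1)) = 2 * 2 ^ L ≤ 4 / ε`,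
    -- below `16 / ε`.
    refine abs_le_of_sq_le_sq' (a := (q ^ (L + 1)) ^ 2) ?_ (by positivity) |>.2
    have e1 : ((q ^ (L + 1)) ^ 2) ^ 2 = 2 * 2 ^ L := by
      rw [← hq4]; ring
    have e2 : (2 * 2 * ε ^ (-(1 / 2) : ℝ)) ^ 2 = 16 * ε⁻¹ := by
      rw [mul_pow, ← Real.rpow_natCast (ε ^ _), ← Real.rpow_mul hε.le]
      norm_num [Real.rpow_neg_one]
    rw [e1, e2]
    have := two_pow_finestLevel_le hε hε1
    have := inv_pos.2 hε
    linarith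
  calc allocationSum L ^ 2 ≤ (q ^ (L + 1) / (q - 1)) ^ 2 :=
        pow_le_pow_left₀ (allocationSum_pos L).le hsum 2
    _ = (q ^ (L + 1)) ^ 2 / (q - 1) ^ 2 := div_pow _ _ _
    _ ≤ 2 * 2 * ε ^ (-(1 / 2) : ℝ) / (q - 1) ^ 2 := by gcongr
    _ = _ := by ring

/-- Rounding up costs at most one sample per level, in total `∑ 2^l = O(ε⁻¹)`. The main term is `ε⁻²
K²`, and `K² = O(ε^{-1/2})`. -/
theorem multilevelCost_le {ε : ℝ} (hε : 0 < ε) (hε1 : ε < 1) :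
    multilevelCost (finestLevel ε) (sampleSizes ε) ≤
      (4 + 2 * 2 / ((2 : ℝ) ^ (1 / 4 : ℝ) - 1) ^ 2) * ε ^ (-(5 / 2) : ℝ) := by
  set L := finestLevel ε with hL
  set K := allocationSum L with hK
  have h5 : ε⁻¹ ≤ ε ^ (-(5 / 2) : ℝ) := by
    rw [← Real.rpow_neg_one]
    exact Real.rpow_le_rpow_of_exponent_ge hε hε1.le (by norm_num)
  have hε2 : 0 ≤ ε ^ (-2 : ℝ) := Real.rpow_nonneg hε.le _
  have hterm : ∀ l, (sampleSizes ε l : ℝ) * (stepSize l)⁻¹ ≤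
      2 ^ l + ε ^ (-2 : ℝ) * K * stepSize l ^ (-(1 / 4) : ℝ) := by
    intro l
    have hh := stepSize_pos l
    have e : stepSize l ^ (3 / 4 : ℝ) * (stepSize l)⁻¹ = stepSize l ^ (-(1 / 4) : ℝ) := by
      rw [← Real.rpow_neg_one, ← Real.rpow_add hh]; norm_num
    have e' : (stepSize l)⁻¹ = 2 ^ l := by simp [stepSize]
    refine (mul_le_mul_of_nonneg_right (sampleSizes_le hε l) (by positivity)).trans_eq ?_
    rw [← e, ← e']
    ring
  have hgeom : ∑ l ∈ Finset.range (L + 1), (2 : ℝ) ^ l ≤ 4 * ε⁻¹ := by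
    rw [geom_sum_eq (by norm_num)]
    have := two_pow_finestLevel_le hε hε1
    rw [pow_succ]
    linarith
  calc multilevelCost L (sampleSizes ε) ≤ ∑ l ∈ Finset.range (L + 1),
        (2 ^ l + ε ^ (-2 : ℝ) * K * stepSize l ^ (-(1 / 4) : ℝ)) :=
        Finset.sum_le_sum fun l _ => hterm l
    _ = ∑ l ∈ Finset.range (L + 1), (2 : ℝ) ^ l + ε ^ (-2 : ℝ) * K ^ 2 := by
        rw [Finset.sum_add_distrib, ← Finset.mul_sum, sq, mul_assoc]; rfl
    _ ≤ 4 * ε⁻¹ + ε ^ (-2 : ℝ) *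
          (2 * 2 / ((2 : ℝ) ^ (1 / 4 : ℝ) - 1) ^ 2 * ε ^ (-(1 / 2) : ℝ)) :=
        add_le_add hgeom (mul_le_mul_of_nonneg_left (allocationSum_sq_le hε hε1) hε2)
    _ = 4 * ε⁻¹ + 2 * 2 / ((2 : ℝ) ^ (1 / 4 : ℝ) - 1) ^ 2 * ε ^ (-(5 / 2) : ℝ) := by
        have : ε ^ (-(5 / 2) : ℝ) = ε ^ (-2 : ℝ) * ε ^ (-(1 / 2) : ℝ) := by
          rw [← Real.rpow_add hε]; norm_num
        rw [this]; ring
    _ ≤ _ := by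
        rw [add_mul]; gcongr

end Cost

/-! ### Iterates of Markov kernels -/

section KernelPower

variable {S T : Type*} [MeasurableSpace S] [MeasurableSpace T]

lemma lintegral_kernel_pow_succ (K : Kernel S S) (n : ℕ) (s : S) {f : S → ENNReal}
    (hf : Measurable f) :
    ∫⁻ z, f z ∂((K ^ (n + 1)) s) = ∫⁻ y, ∫⁻ z, f z ∂((K ^ n) y) ∂(K s) := by
  rw [pow_succ]
  exact Kernel.lintegral_comp (K ^ n) K s hf

lemma lintegral_kernel_pow_zero (K : Kernel S S) (s : S) {f : S → ENNReal} (hf : Measurable f) :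
    ∫⁻ z, f z ∂((K ^ 0) s) = f s := by
  change ∫⁻ z, f z ∂(Kernel.id s) = f s
  rw [Kernel.id_apply, lintegral_dirac' s hf]

/-- A kernel that multiplies `f` by at most `C` on average multiplies it by at most `C ^ n` in `n`
steps. -/
lemma lintegral_kernel_pow_le {K : Kernel S S} {f : S → ENNReal} (hf : Measurable f) {C : ENNReal}
    (h : ∀ s, ∫⁻ z, f z ∂(K s) ≤ C * f s) (n : ℕ) (s : S) :
    ∫⁻ z, f z ∂((K ^ n) s) ≤ C ^ n * f s := by
  induction n generalizing s with
  | zero => rw [lintegral_kernel_pow_zero K s hf]; simp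
  | succ n ih =>
    rw [lintegral_kernel_pow_succ K n s hf]
    calc _ ≤ ∫⁻ y, C ^ n * f y ∂(K s) := lintegral_mono ih
      _ = C ^ n * ∫⁻ y, f y ∂(K s) := lintegral_const_mul _ hf
      _ ≤ C ^ n * (C * f s) := by gcongr; exact h s
      _ = _ := by ring

lemma map_kernel_pow {K : Kernel S S} {K' : Kernel T T} {π : S → T} (hπ : Measurable π)
    (h : ∀ s, (K s).map π = K' (π s)) (n : ℕ) (s : S) : ((K ^ n) s).map π = (K' ^ n) (π s) := by
  refine Measure.ext_of_lintegral _ fun f hf => ?_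
  rw [lintegral_map hf hπ]
  have hfπ : Measurable fun s => f (π s) := hf.comp hπ
  induction n generalizing s with
  | zero => rw [lintegral_kernel_pow_zero K s hfπ, lintegral_kernel_pow_zero K' _ hf]
  | succ n ih =>
    rw [lintegral_kernel_pow_succ K n s hfπ, lintegral_kernel_pow_succ K' n _ hf, ← h,
      lintegral_map hf.lintegral_kernel hπ]
    exact lintegral_congr fun y => ih y

end KernelPower

/-! ### The coupled Euler kernel is a coupling -/

section EulerCoupling

variable {d : ℕ} (a : C(EuclideanSpace ℝ (Fin d), EuclideanSpace ℝ (Fin d)))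
  (b : C(EuclideanSpace ℝ (Fin d), EuclideanSpace ℝ (Fin d) →L[ℝ] EuclideanSpace ℝ (Fin d)))

/-- The standard Gaussian law on `ℝ^d`. -/
local notation "γ" => stdGaussian (EuclideanSpace ℝ (Fin d))

lemma eulerStep_apply (h : ℝ) (x : EuclideanSpace ℝ (Fin d)) :
    eulerStep a b h x = (γ).map fun ξ => eulerMap a b h x (√h • ξ) := by
  have hm : Measurable fun p : EuclideanSpace ℝ (Fin d) × EuclideanSpace ℝ (Fin d) =>
      eulerMap a b h p.1 (√h • p.2) := ((continuous_eulerMap a b h).comp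
    (f := fun p : EuclideanSpace ℝ (Fin d) × EuclideanSpace ℝ (Fin d) => (p.1, √h • p.2))
      (by fun_prop)).measurable
  rw [eulerStep, Kernel.map_apply _ hm, Kernel.prod_apply, Kernel.id_apply, Kernel.const_apply,
    Measure.dirac_prod, Measure.map_map hm (by fun_prop)]
  rfl

lemma coupledEulerStep_apply (h : ℝ)
    (p : EuclideanSpace ℝ (Fin d) × EuclideanSpace ℝ (Fin d)) :
    coupledEulerStep a b h p = ((γ).prod γ).map fun q =>
      (eulerMap a b h (eulerMap a b h p.1 (√h • q.1)) (√h • q.2),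
        eulerMap a b (2 * h) p.2 (√h • (q.1 + q.2))) := by
  rw [coupledEulerStep, Kernel.map_apply _ (Continuous.measurable (by unfold eulerMap; fun_prop)),
    Kernel.prod_apply, Kernel.id_apply, Kernel.const_apply, Measure.dirac_prod,
    Measure.map_map (Continuous.measurable (by unfold eulerMap; fun_prop)) (by fun_prop)]
  rfl

/-- Gives the coarse component its correct marginal; the two laws have the same characteristic
function. -/
lemma map_smul_add_stdGaussian {h : ℝ} (hh : 0 ≤ h) :
    ((γ).prod γ).map (fun q => √h • (q.1 + q.2)) = (γ).map fun ξ => √(2 * h) • ξ := by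
  have e : (fun q : EuclideanSpace ℝ (Fin d) × EuclideanSpace ℝ (Fin d) => √h • (q.1 + q.2)) =
      (fun z => √h • z) ∘ fun q => q.1 + q.2 := rfl
  rw [e, ← Measure.map_map (by fun_prop) (by fun_prop)]
  change Measure.map (fun z => √h • z) (γ ∗ γ) = _
  have : IsProbabilityMeasure (Measure.map (fun z => √h • z) (γ ∗ γ)) :=
    Measure.isProbabilityMeasure_map (by fun_prop)
  have : IsProbabilityMeasure ((γ).map fun ξ => √(2 * h) • ξ) :=
    Measure.isProbabilityMeasure_map (by fun_prop)
  refine Measure.ext_of_charFun (funext fun t => ?_)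
  rw [charFun_map_smul, charFun_map_smul, charFun_conv, charFun_stdGaussian, charFun_stdGaussian,
    ← Complex.exp_add]
  congr 1
  simp only [norm_smul, Real.norm_eq_abs, abs_of_nonneg (Real.sqrt_nonneg _)]
  have h1 : (√h * ‖t‖) ^ 2 = h * ‖t‖ ^ 2 := by rw [mul_pow, Real.sq_sqrt hh]
  have h2 : (√(2 * h) * ‖t‖) ^ 2 = 2 * h * ‖t‖ ^ 2 := by
    rw [mul_pow, Real.sq_sqrt (by positivity)]
  rw [← Complex.ofReal_pow, ← Complex.ofReal_pow, h1, h2]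
  push_cast
  ring

lemma coupledEulerStep_map_fst (h : ℝ)
    (p : EuclideanSpace ℝ (Fin d) × EuclideanSpace ℝ (Fin d)) :
    (coupledEulerStep a b h p).map Prod.fst = (eulerStep a b h ^ 2) p.1 := by
  have hm : ∀ x : EuclideanSpace ℝ (Fin d), Measurable fun ξ => eulerMap a b h x (√h • ξ) :=
    fun x => Continuous.measurable (by unfold eulerMap; fun_prop)
  have hm2 : Measurable fun q : EuclideanSpace ℝ (Fin d) × EuclideanSpace ℝ (Fin d) =>
      (eulerMap a b h (eulerMap a b h p.1 (√h • q.1)) (√h • q.2),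
        eulerMap a b (2 * h) p.2 (√h • (q.1 + q.2))) :=
    Continuous.measurable (by unfold eulerMap; fun_prop)
  refine Measure.ext_of_lintegral _ fun f hf => ?_
  have hf1 : Measurable fun z : EuclideanSpace ℝ (Fin d) × EuclideanSpace ℝ (Fin d) => f z.1 :=
    hf.comp measurable_fst
  have e : eulerStep a b h ^ 2 = eulerStep a b h ∘ₖ eulerStep a b h := sq _
  rw [e, Kernel.lintegral_comp _ _ _ hf, eulerStep_apply,
    lintegral_map hf.lintegral_kernel (hm _), coupledEulerStep_apply,
    lintegral_map hf measurable_fst, lintegral_map hf1 hm2]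
  refine (lintegral_prod _ (hf1.comp hm2).aemeasurable).trans ?_
  refine lintegral_congr fun ξ => ?_
  rw [eulerStep_apply, lintegral_map hf (hm _)]
  rfl

lemma coupledEulerStep_map_snd {h : ℝ} (hh : 0 ≤ h)
    (p : EuclideanSpace ℝ (Fin d) × EuclideanSpace ℝ (Fin d)) :
    (coupledEulerStep a b h p).map Prod.snd = eulerStep a b (2 * h) p.2 := by
  have hm : Measurable fun w => eulerMap a b (2 * h) p.2 w := by unfold eulerMap; fun_prop
  rw [coupledEulerStep_apply, eulerStep_apply,
    Measure.map_map (by fun_prop) (Continuous.measurable (by unfold eulerMap; fun_prop))]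
  have e1 : (fun ξ : EuclideanSpace ℝ (Fin d) => eulerMap a b (2 * h) p.2 (√(2 * h) • ξ)) =
      (fun w => eulerMap a b (2 * h) p.2 w) ∘ fun ξ => √(2 * h) • ξ := rfl
  rw [e1, ← Measure.map_map hm (by fun_prop), ← map_smul_add_stdGaussian hh,
    Measure.map_map hm (by fun_prop)]
  rfl

theorem isMultilevelCoupling_euler :
    IsMultilevelCoupling (eulerKernel a b) (coupledEulerKernel a b) := by
  intro l x x'
  constructor
  -- At level `l + 1` there are `2 ^ l` coupled steps. Each projects to two fine steps, giving `2 ^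
  -- (l + 1)` in all, or to one coarse step of size `2 h_{l+1} = h_l`.
  · rw [coupledEulerKernel, eulerKernel, Nat.add_sub_cancel, map_kernel_pow measurable_fst
      (fun p => coupledEulerStep_map_fst a b (stepSize (l + 1)) p), ← pow_mul, ← pow_succ']
  · rw [coupledEulerKernel, eulerKernel, Nat.add_sub_cancel, map_kernel_pow measurable_snd
      (fun p => coupledEulerStep_map_snd a b (stepSize_pos (l + 1)).le p), two_mul_stepSize_succ]

end EulerCoupling

/-! ### Stability of the coupled Euler scheme -/

section EulerStability

variable {d : ℕ}

/-- The second moment of the standard Gaussian law on `ℝ^d`. -/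
noncomputable def gaussianMoment (d : ℕ) : ℝ :=
  ∫ ξ, ‖ξ‖ ^ 2 ∂(stdGaussian (EuclideanSpace ℝ (Fin d)))

lemma gaussianMoment_nonneg (d : ℕ) : 0 ≤ gaussianMoment d :=
  integral_nonneg fun _ => sq_nonneg _

lemma integrable_norm_sq_stdGaussian :
    Integrable (fun ξ => ‖ξ‖ ^ 2) (stdGaussian (EuclideanSpace ℝ (Fin d))) :=
  MemLp.integrable_norm_pow (p := 2) (f := id) IsGaussian.memLp_two_id two_ne_zero

lemma integrable_norm_add_sq_stdGaussian (u : EuclideanSpace ℝ (Fin d))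
    (T : EuclideanSpace ℝ (Fin d) →L[ℝ] EuclideanSpace ℝ (Fin d)) :
    Integrable (fun ξ => ‖u + T ξ‖ ^ 2) (stdGaussian (EuclideanSpace ℝ (Fin d))) := by
  have h : MemLp (fun ξ => u + T ξ) 2 (stdGaussian (EuclideanSpace ℝ (Fin d))) :=
    (memLp_const u).add (T.comp_memLp' IsGaussian.memLp_two_id)
  exact MemLp.integrable_norm_pow (p := 2) h two_ne_zero

/-- The cross term vanishes because the Gaussian is centred. Hence the noise, of size `√h`,
contributes only at order `h`. -/
lemma integral_norm_add_sq_stdGaussian_le (u : EuclideanSpace ℝ (Fin d))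
    (T : EuclideanSpace ℝ (Fin d) →L[ℝ] EuclideanSpace ℝ (Fin d)) :
    ∫ ξ, ‖u + T ξ‖ ^ 2 ∂(stdGaussian (EuclideanSpace ℝ (Fin d))) ≤
      ‖u‖ ^ 2 + ‖T‖ ^ 2 * gaussianMoment d := by
  have hT : MemLp (fun ξ => T ξ) 2 (stdGaussian (EuclideanSpace ℝ (Fin d))) :=
    T.comp_memLp' IsGaussian.memLp_two_id
  have hTi := hT.integrable one_le_two
  have hT2 : Integrable (fun ξ => ‖T ξ‖ ^ 2) (stdGaussian (EuclideanSpace ℝ (Fin d))) :=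
    MemLp.integrable_norm_pow (p := 2) hT two_ne_zero
  have h0 : ∫ ξ, inner ℝ u (T ξ) ∂(stdGaussian (EuclideanSpace ℝ (Fin d))) = 0 := by
    rw [integral_inner hTi u, T.integral_comp_id_comm IsGaussian.integrable_id,
      integral_id_stdGaussian, map_zero, inner_zero_right]
  have hi : Integrable (fun ξ => inner ℝ u (T ξ)) (stdGaussian (EuclideanSpace ℝ (Fin d))) :=
    hTi.const_inner u
  simp only [norm_add_sq_real]
  have hi2 : Integrable (fun ξ => ‖u‖ ^ 2 + 2 * inner ℝ u (T ξ))
    (stdGaussian (EuclideanSpace ℝ (Fin d))) := (integrable_const _).add (hi.const_mul 2)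
  rw [integral_add hi2 hT2, integral_add (integrable_const _) (hi.const_mul 2), integral_const_mul, h0]
  simp only [integral_const, probReal_univ, one_smul, mul_zero, add_zero]
  gcongr
  rw [gaussianMoment, ← integral_const_mul]
  refine integral_mono hT2 (integrable_norm_sq_stdGaussian.const_mul _) fun ξ => ?_
  simp only [← mul_pow]
  exact pow_le_pow_left₀ (norm_nonneg _) (T.le_opNorm ξ) 2

/-- Passage to `∫⁻`, in which one-step bounds iterate over kernel powers without any integrability
to carry along. -/
lemma lintegral_ofReal_le_of_le {Ω : Type*} [MeasurableSpace Ω] {μ : Measure Ω} {F G : Ω → ℝ}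
    {C : ℝ} (hFG : ∀ ω, F ω ≤ G ω) (hG : Integrable G μ) (hG0 : ∀ ω, 0 ≤ G ω)
    (hC : ∫ ω, G ω ∂μ ≤ C) : ∫⁻ ω, ENNReal.ofReal (F ω) ∂μ ≤ ENNReal.ofReal C := by
  refine (lintegral_mono fun ω => ENNReal.ofReal_le_ofReal (hFG ω)).trans ?_
  rw [← ofReal_integral_eq_lintegral_ofReal hG (ae_of_all _ hG0)]
  exact ENNReal.ofReal_le_ofReal hC

/-- Lipschitz and growth bounds for the coefficients. -/
structure CoefficientBounds (a : C(EuclideanSpace ℝ (Fin d), EuclideanSpace ℝ (Fin d)))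
    (b : C(EuclideanSpace ℝ (Fin d), EuclideanSpace ℝ (Fin d) →L[ℝ] EuclideanSpace ℝ (Fin d)))
    (Λ Γ : ℝ) : Prop where
  lip_nonneg : 0 ≤ Λ
  growth_nonneg : 0 ≤ Γ
  drift_sub : ∀ x x', ‖a x - a x'‖ ≤ Λ * ‖x - x'‖
  diffusion_sub : ∀ x x', ‖b x - b x'‖ ≤ Λ * ‖x - x'‖
  drift_growth : ∀ x, ‖a x‖ ^ 2 ≤ Γ * (1 + ‖x‖ ^ 2)
  diffusion_growth : ∀ x, ‖b x‖ ^ 2 ≤ Γ * (1 + ‖x‖ ^ 2)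

lemma sq_norm_le_of_lipschitz {E F : Type*} [NormedAddCommGroup E] [NormedAddCommGroup F]
    {f : E → F} {Λ : ℝ} (h : ∀ x x', ‖f x - f x'‖ ≤ Λ * ‖x - x'‖) (x : E) :
    ‖f x‖ ^ 2 ≤ 2 * (‖f 0‖ ^ 2 + Λ ^ 2) * (1 + ‖x‖ ^ 2) := by
  have h1 : ‖f x‖ ≤ Λ * ‖x‖ + ‖f 0‖ := by
    have := h x 0
    rw [sub_zero] at this
    linarith [norm_le_norm_add_norm_sub' (f x) (f 0)]
  have h2 : ‖f x‖ ^ 2 ≤ (Λ * ‖x‖ + ‖f 0‖) ^ 2 := pow_le_pow_left₀ (norm_nonneg _) h1 2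
  have h3 := sq_nonneg (Λ * ‖x‖ - ‖f 0‖)
  have h4 : 0 ≤ ‖f 0‖ ^ 2 * ‖x‖ ^ 2 := by positivity
  have h5 := sq_nonneg Λ
  linarith

lemma DiffusionAssumption.exists_coefficientBounds
    {a : C(EuclideanSpace ℝ (Fin d), EuclideanSpace ℝ (Fin d))}
    {b : C(EuclideanSpace ℝ (Fin d), EuclideanSpace ℝ (Fin d) →L[ℝ] EuclideanSpace ℝ (Fin d))}
    (h : DiffusionAssumption a b) : ∃ Λ Γ, CoefficientBounds a b Λ Γ := by
  obtain ⟨Λ, hΛ, hl⟩ := h.lipschitz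
  have ha : ∀ x x', ‖a x - a x'‖ ≤ Λ * ‖x - x'‖ := fun x x' =>
    (le_add_of_nonneg_right (norm_nonneg _)).trans (hl x x')
  have hb : ∀ x x', ‖b x - b x'‖ ≤ Λ * ‖x - x'‖ := fun x x' =>
    (le_add_of_nonneg_left (norm_nonneg _)).trans (hl x x')
  refine ⟨Λ, 2 * (‖a 0‖ ^ 2 + Λ ^ 2) + 2 * (‖b 0‖ ^ 2 + Λ ^ 2), hΛ.le, by positivity, ha, hb,
    fun x => (sq_norm_le_of_lipschitz ha x).trans ?_,
    fun x => (sq_norm_le_of_lipschitz hb x).trans ?_⟩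
  · gcongr; exact le_add_of_nonneg_right (by positivity)
  · gcongr; exact le_add_of_nonneg_left (by positivity)

/-- Lyapunov function for the coupled Euler scheme with step `h`. -/
noncomputable def eulerLyapunov (h : ℝ)
    (p : EuclideanSpace ℝ (Fin d) × EuclideanSpace ℝ (Fin d)) : ℝ :=
  ‖p.1 - p.2‖ ^ 2 + h * (1 + ‖p.1‖ ^ 2)

lemma eulerLyapunov_nonneg {h : ℝ} (hh : 0 ≤ h)
    (p : EuclideanSpace ℝ (Fin d) × EuclideanSpace ℝ (Fin d)) : 0 ≤ eulerLyapunov h p := by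
  unfold eulerLyapunov; positivity

lemma measurable_eulerLyapunov (h : ℝ) : Measurable (eulerLyapunov (d := d) h) :=
  Continuous.measurable (by unfold eulerLyapunov; fun_prop)

/-- Growth rate of the second moment of an Euler step. -/
noncomputable def momentRate (Γ m : ℝ) : ℝ := 1 + 2 * Γ + m * Γ

/-- Growth rate of `eulerLyapunov` in a coupled Euler step. -/
noncomputable def lyapunovRate (Λ Γ m : ℝ) : ℝ :=
  (1 + 2 * (4 * Λ + 4 * Λ ^ 2 + m * Λ ^ 2) + 2 * m * Λ ^ 2) +
    (2 * momentRate Γ m + momentRate Γ m ^ 2 + (2 * Λ ^ 2 + 2 * m * Λ ^ 2) * ((1 + m) * Γ))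

variable {a : C(EuclideanSpace ℝ (Fin d), EuclideanSpace ℝ (Fin d))}
  {b : C(EuclideanSpace ℝ (Fin d), EuclideanSpace ℝ (Fin d) →L[ℝ] EuclideanSpace ℝ (Fin d))}
  {Λ Γ : ℝ}

lemma norm_add_smul_sq_le {E : Type*} [NormedAddCommGroup E] [InnerProductSpace ℝ E] {h : ℝ}
    (hh : 0 ≤ h) (hh1 : h ≤ 1) {x v : E} (hv : ‖v‖ ^ 2 ≤ Γ * (1 + ‖x‖ ^ 2)) :
    ‖x + h • v‖ ^ 2 ≤ ‖x‖ ^ 2 + h * ((1 + 2 * Γ) * (1 + ‖x‖ ^ 2)) := by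
  rw [norm_add_sq_real, inner_smul_right, norm_smul, mul_pow, Real.norm_eq_abs, sq_abs]
  have h1 : 2 * inner ℝ x v ≤ ‖x‖ ^ 2 + ‖v‖ ^ 2 := by
    have := norm_sub_sq_real x v
    have := sq_nonneg ‖x - v‖
    linarith
  have h2 : h ^ 2 * ‖v‖ ^ 2 ≤ h * ‖v‖ ^ 2 :=
    mul_le_mul_of_nonneg_right (by nlinarith) (sq_nonneg _)
  have h3 := mul_le_mul_of_nonneg_left h1 hh
  have h4 := mul_le_mul_of_nonneg_left hv hh
  nlinarith

lemma norm_smul_sq_eq {h : ℝ} (hh : 0 ≤ h)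
    (T : EuclideanSpace ℝ (Fin d) →L[ℝ] EuclideanSpace ℝ (Fin d)) : ‖√h • T‖ ^ 2 = h * ‖T‖ ^ 2 := by
  rw [norm_smul, mul_pow, Real.norm_eq_abs, sq_abs, Real.sq_sqrt hh]

/-- Mean of `1 + |x|^2` after an Euler step. -/
lemma CoefficientBounds.integral_euler_le (H : CoefficientBounds a b Λ Γ) {h : ℝ} (hh : 0 ≤ h)
    (hh1 : h ≤ 1) (x : EuclideanSpace ℝ (Fin d)) :
    ∫ ξ, (1 + ‖(x + h • a x) + (√h • b x) ξ‖ ^ 2) ∂(stdGaussian (EuclideanSpace ℝ (Fin d))) ≤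
      (1 + momentRate Γ (gaussianMoment d) * h) * (1 + ‖x‖ ^ 2) := by
  have hm := gaussianMoment_nonneg d
  rw [integral_add (integrable_const _) (integrable_norm_add_sq_stdGaussian _ _)]
  have h1 := integral_norm_add_sq_stdGaussian_le (x + h • a x) (√h • b x)
  have h2 := norm_add_smul_sq_le hh hh1 (H.drift_growth x)
  rw [norm_smul_sq_eq hh] at h1
  have h3 := mul_le_mul_of_nonneg_left (H.diffusion_growth x) (mul_nonneg hh hm)
  simp only [integral_const, probReal_univ, one_smul]
  unfold momentRate
  nlinarith

/-- Pointwise bound for the conditional mean of the squared distance after a coupled step, given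
the first Gaussian increment. -/
lemma CoefficientBounds.inner_step_le (H : CoefficientBounds a b Λ Γ) {h m : ℝ} (hh : 0 < h)
    (hh1 : h ≤ 1) (hm : 0 ≤ m) (x x' w v : EuclideanSpace ℝ (Fin d)) :
    ‖v + h • (a (x + w) - a x)‖ ^ 2 + h * ‖b (x + w) - b x'‖ ^ 2 * m ≤
      (1 + h) * ‖v‖ ^ 2 + h * (2 * Λ ^ 2 + 2 * m * Λ ^ 2) * ‖w‖ ^ 2 +
        2 * h * m * Λ ^ 2 * ‖x - x'‖ ^ 2 := by
  have hΛ := H.lip_nonneg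
  set r := h • (a (x + w) - a x) with hr
  have h1 : ‖a (x + w) - a x‖ ^ 2 ≤ Λ ^ 2 * ‖w‖ ^ 2 := by
    rw [← mul_pow]
    refine pow_le_pow_left₀ (norm_nonneg _) ?_ 2
    simpa using H.drift_sub (x + w) x
  have h2 : ‖b (x + w) - b x'‖ ^ 2 ≤ 2 * Λ ^ 2 * (‖x - x'‖ ^ 2 + ‖w‖ ^ 2) := by
    have h3 : ‖b (x + w) - b x'‖ ≤ Λ * (‖x - x'‖ + ‖w‖) := by
      refine (H.diffusion_sub _ _).trans (mul_le_mul_of_nonneg_left ?_ hΛ)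
      have : x + w - x' = (x - x') + w := by abel
      rw [this]; exact norm_add_le _ _
    have h4 := pow_le_pow_left₀ (norm_nonneg _) h3 2
    have h5 := mul_nonneg (sq_nonneg Λ) (sq_nonneg (‖x - x'‖ - ‖w‖))
    nlinarith
  -- Young's inequality `‖v + r‖² ≤ (1 + h) ‖v‖² + (1 + 1/h) ‖r‖²`, multiplied by `h`. As `r`
  -- carries a factor `h`, the loss `1/h` still leaves a term `O(h) ‖w‖²`.
  have h6 : h * ‖v + r‖ ^ 2 ≤ h * ((1 + h) * ‖v‖ ^ 2) + (1 + h) * ‖r‖ ^ 2 := by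
    have h7 := norm_sub_sq_real (h • v) r
    have h8 := sq_nonneg ‖h • v - r‖
    rw [norm_smul, mul_pow, Real.norm_eq_abs, sq_abs, real_inner_smul_left] at h7
    rw [norm_add_sq_real]
    nlinarith
  have h9 : ‖r‖ ^ 2 ≤ h ^ 2 * (Λ ^ 2 * ‖w‖ ^ 2) := by
    rw [hr, norm_smul, mul_pow, Real.norm_eq_abs, sq_abs]
    gcongr
  have h10 : ‖v + r‖ ^ 2 ≤ (1 + h) * ‖v‖ ^ 2 + 2 * h * (Λ ^ 2 * ‖w‖ ^ 2) := by
    refine le_of_mul_le_mul_left (h6.trans ?_) hh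
    have h11 : (1 + h) * ‖r‖ ^ 2 ≤ 2 * (h ^ 2 * (Λ ^ 2 * ‖w‖ ^ 2)) :=
      mul_le_mul (by linarith) h9 (sq_nonneg _) (by norm_num)
    nlinarith
  have h12 := mul_le_mul_of_nonneg_left h2 (mul_nonneg hh.le hm)
  nlinarith

/-- A coupled Euler step of size `h` multiplies `eulerLyapunov h` by at most `1 + O(h)`. -/
theorem CoefficientBounds.lintegral_coupledEulerStep_le (H : CoefficientBounds a b Λ Γ) {h : ℝ}
    (hh : 0 < h) (hh1 : h ≤ 1) (p : EuclideanSpace ℝ (Fin d) × EuclideanSpace ℝ (Fin d)) :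
    ∫⁻ z, ENNReal.ofReal (eulerLyapunov h z) ∂(coupledEulerStep a b h p) ≤
      ENNReal.ofReal (1 + lyapunovRate Λ Γ (gaussianMoment d) * h) *
        ENNReal.ofReal (eulerLyapunov h p) := by
  obtain ⟨x, x'⟩ := p
  have hm := gaussianMoment_nonneg d
  set m := gaussianMoment d with hmdef
  have hΛ := H.lip_nonneg
  have hΓ := H.growth_nonneg
  have hR : 0 ≤ momentRate Γ m := by unfold momentRate; positivity
  set R := momentRate Γ m with hRdef
  have hstep : Measurable fun q : EuclideanSpace ℝ (Fin d) × EuclideanSpace ℝ (Fin d) =>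
      (eulerMap a b h (eulerMap a b h x (√h • q.1)) (√h • q.2),
        eulerMap a b (2 * h) x' (√h • (q.1 + q.2))) :=
    Continuous.measurable (by unfold eulerMap; fun_prop)
  have hf : Measurable fun z : EuclideanSpace ℝ (Fin d) × EuclideanSpace ℝ (Fin d) =>
      ENNReal.ofReal (eulerLyapunov h z) := (measurable_eulerLyapunov h).ennreal_ofReal
  rw [coupledEulerStep_apply, lintegral_map hf hstep]
  refine (lintegral_prod _ (hf.comp hstep).aemeasurable).trans_le ?_
  -- `w` is the first fine increment. `v` is what the difference of the components would be if both
  -- fine drifts were taken at `x` and the second noise were dropped.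
  let w : EuclideanSpace ℝ (Fin d) → EuclideanSpace ℝ (Fin d) := fun ξ =>
    h • a x + (√h • b x) ξ
  let v : EuclideanSpace ℝ (Fin d) → EuclideanSpace ℝ (Fin d) := fun ξ =>
    ((x - x') + (2 * h) • (a x - a x')) + (√h • (b x - b x')) ξ
  let G : EuclideanSpace ℝ (Fin d) → ℝ := fun ξ =>
    ((1 + h) * ‖v ξ‖ ^ 2 + h * (2 * Λ ^ 2 + 2 * m * Λ ^ 2) * ‖w ξ‖ ^ 2 +
      2 * h * m * Λ ^ 2 * ‖x - x'‖ ^ 2) +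
      h * ((1 + R * h) * (1 + ‖(x + h • a x) + (√h • b x) ξ‖ ^ 2))
  have hinner : ∀ ξ : EuclideanSpace ℝ (Fin d),
      ∫⁻ ζ, ENNReal.ofReal (eulerLyapunov h
        (eulerMap a b h (eulerMap a b h x (√h • ξ)) (√h • ζ),
          eulerMap a b (2 * h) x' (√h • (ξ + ζ)))) ∂(stdGaussian (EuclideanSpace ℝ (Fin d))) ≤
        ENNReal.ofReal (G ξ) := by
    intro ξ
    set y := x + w ξ with hy
    have hyx : eulerMap a b h x (√h • ξ) = y := by
      simp only [eulerMap, hy, w, map_smul, smul_apply, add_assoc]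
    have hyx' : (x + h • a x) + (√h • b x) ξ = y := by
      simp only [hy, w, add_assoc]
    set u := v ξ + h • (a y - a x) with hu
    -- Given `ξ`, the final difference is affine in `ζ`, so the Gaussian second moment bound applies
    -- to the inner integral.
    have hdiff : ∀ ζ, eulerMap a b h y (√h • ζ) - eulerMap a b (2 * h) x' (√h • (ξ + ζ)) =
        u + (√h • (b y - b x')) ζ := by
      intro ζ
      have e : y = x + (h • a x + √h • b x ξ) := by
        simp only [hy, w, smul_apply]
      simp only [eulerMap, hu, v, map_smul, map_add, smul_apply,
        sub_apply]
      rw [show y + h • a y + √h • (b y) ζ = x + (h • a x + √h • b x ξ) + h • a y + √h • (b y) ζ by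
        rw [← e]]
      module
    have hi1 := integrable_norm_add_sq_stdGaussian u (√h • (b y - b x'))
    have hi2 : Integrable (fun ζ => h * (1 + ‖(y + h • a y) + (√h • b y) ζ‖ ^ 2))
        (stdGaussian (EuclideanSpace ℝ (Fin d))) :=
      ((integrable_const _).add (integrable_norm_add_sq_stdGaussian _ _)).const_mul _
    refine lintegral_ofReal_le_of_le (G := fun ζ => ‖u + (√h • (b y - b x')) ζ‖ ^ 2 +
      h * (1 + ‖(y + h • a y) + (√h • b y) ζ‖ ^ 2)) (fun ζ => ?_)
      (hi1.add hi2) (fun ζ => by positivity) ?_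
    · refine le_of_eq ?_
      rw [hyx]
      simp only [eulerLyapunov, hdiff]
      simp only [eulerMap, map_smul, smul_apply]
    · rw [integral_add hi1 hi2, integral_const_mul]
      refine add_le_add ?_ (mul_le_mul_of_nonneg_left ?_ hh.le)
      · refine (integral_norm_add_sq_stdGaussian_le _ _).trans ?_
        rw [norm_smul_sq_eq hh.le]
        exact H.inner_step_le hh hh1 hm x x' (w ξ) (v ξ)
      · rw [hyx']
        exact H.integral_euler_le hh.le hh1 y
  have hiv : Integrable (fun ξ => (1 + h) * ‖v ξ‖ ^ 2)
      (stdGaussian (EuclideanSpace ℝ (Fin d))) :=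
    (integrable_norm_add_sq_stdGaussian _ _).const_mul _
  have hiw : Integrable (fun ξ => h * (2 * Λ ^ 2 + 2 * m * Λ ^ 2) * ‖w ξ‖ ^ 2)
      (stdGaussian (EuclideanSpace ℝ (Fin d))) :=
    (integrable_norm_add_sq_stdGaussian _ _).const_mul _
  have hiy : Integrable (fun ξ => h * ((1 + R * h) * (1 + ‖(x + h • a x) + (√h • b x) ξ‖ ^ 2)))
      (stdGaussian (EuclideanSpace ℝ (Fin d))) :=
    (((integrable_const _).add (integrable_norm_add_sq_stdGaussian _ _)).const_mul _).const_mul _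
  have hivw : Integrable (fun ξ => (1 + h) * ‖v ξ‖ ^ 2 +
      h * (2 * Λ ^ 2 + 2 * m * Λ ^ 2) * ‖w ξ‖ ^ 2) (stdGaussian (EuclideanSpace ℝ (Fin d))) :=
    hiv.add hiw
  have hivwc : Integrable (fun ξ => (1 + h) * ‖v ξ‖ ^ 2 +
      h * (2 * Λ ^ 2 + 2 * m * Λ ^ 2) * ‖w ξ‖ ^ 2 + 2 * h * m * Λ ^ 2 * ‖x - x'‖ ^ 2)
      (stdGaussian (EuclideanSpace ℝ (Fin d))) := hivw.add (integrable_const _)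
  rw [← ENNReal.ofReal_mul' (eulerLyapunov_nonneg hh.le _)]
  refine (lintegral_mono hinner).trans (lintegral_ofReal_le_of_le (fun ξ => le_rfl)
    (hivwc.add hiy) (fun ξ => by simp only [G]; positivity) ?_)
  simp only [G]
  rw [integral_add hivwc hiy, integral_add hivw (integrable_const _), integral_add hiv hiw,
    integral_const_mul, integral_const_mul, integral_const_mul, integral_const_mul,
    integral_const_mul]
  simp only [v, w]
  simp only [integral_const, probReal_univ, one_smul]
  set δ := ‖x - x'‖ with hδ
  have hδ0 : 0 ≤ δ := norm_nonneg _
  set P := 1 + ‖x‖ ^ 2 with hP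
  have hP0 : 0 ≤ P := by positivity
  have bv : ∫ ξ, ‖(x - x') + (2 * h) • (a x - a x') + (√h • (b x - b x')) ξ‖ ^ 2
      ∂(stdGaussian (EuclideanSpace ℝ (Fin d))) ≤
      (1 + h * (4 * Λ + 4 * Λ ^ 2 + m * Λ ^ 2)) * δ ^ 2 := by
    refine (integral_norm_add_sq_stdGaussian_le _ _).trans ?_
    rw [norm_smul_sq_eq hh.le]
    have k1 : ‖(x - x') + (2 * h) • (a x - a x')‖ ≤ (1 + 2 * h * Λ) * δ := by
      refine (norm_add_le _ _).trans ?_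
      rw [norm_smul, Real.norm_eq_abs, abs_of_pos (by positivity : 0 < 2 * h)]
      have := mul_le_mul_of_nonneg_left (H.drift_sub x x') (by positivity : 0 ≤ 2 * h)
      linarith
    have k2 := pow_le_pow_left₀ (norm_nonneg _) k1 2
    have k3 : ‖b x - b x'‖ ^ 2 ≤ Λ ^ 2 * δ ^ 2 := by
      rw [← mul_pow]; exact pow_le_pow_left₀ (norm_nonneg _) (H.diffusion_sub x x') 2
    have k4 := mul_le_mul_of_nonneg_left k3 (mul_nonneg hh.le hm)
    have k5 : h ^ 2 * (4 * Λ ^ 2 * δ ^ 2) ≤ h * (4 * Λ ^ 2 * δ ^ 2) :=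
      mul_le_mul_of_nonneg_right (by nlinarith) (by positivity)
    nlinarith
  have bw : ∫ ξ, ‖h • a x + (√h • b x) ξ‖ ^ 2 ∂(stdGaussian (EuclideanSpace ℝ (Fin d))) ≤
      h * ((1 + m) * Γ * P) := by
    refine (integral_norm_add_sq_stdGaussian_le _ _).trans ?_
    rw [norm_smul_sq_eq hh.le, norm_smul, mul_pow, Real.norm_eq_abs, sq_abs]
    have k1 : h ^ 2 * ‖a x‖ ^ 2 ≤ h * (Γ * P) :=
      mul_le_mul (by nlinarith) (H.drift_growth x) (by positivity) hh.le
    have k2 := mul_le_mul_of_nonneg_left (H.diffusion_growth x) (mul_nonneg hh.le hm)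
    nlinarith
  have hby := H.integral_euler_le hh.le hh1 x
  calc _ ≤ (1 + h) * ((1 + h * (4 * Λ + 4 * Λ ^ 2 + m * Λ ^ 2)) * δ ^ 2) +
        h * (2 * Λ ^ 2 + 2 * m * Λ ^ 2) * (h * ((1 + m) * Γ * P)) +
        2 * h * m * Λ ^ 2 * δ ^ 2 + h * ((1 + R * h) * ((1 + R * h) * P)) := by
        gcongr
    _ ≤ _ := by
        simp only [eulerLyapunov, lyapunovRate, ← hδ, ← hP, ← hRdef]
        set s := 4 * Λ + 4 * Λ ^ 2 + m * Λ ^ 2 with hs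
        set t := (2 * Λ ^ 2 + 2 * m * Λ ^ 2) * ((1 + m) * Γ) with ht
        have hs0 : 0 ≤ s := by positivity
        have ht0 : 0 ≤ t := by positivity
        have k1 : (1 + h) * (1 + h * s) ≤ 1 + (1 + 2 * s) * h := by
          nlinarith [mul_nonneg hh.le hs0]
        have k2 : (1 + R * h) * (1 + R * h) ≤ 1 + (2 * R + R ^ 2) * h := by
          nlinarith [mul_nonneg (sq_nonneg R) (mul_nonneg hh.le (sub_nonneg.2 hh1))]
        have k3 := mul_le_mul_of_nonneg_right k1 (sq_nonneg δ)
        have k4 := mul_le_mul_of_nonneg_right k2 (mul_nonneg hh.le hP0)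
        -- `δ ^ 2` and `h * P` grow at different rates and `lyapunovRate` is their sum; `k5` and
        -- `k6` are the resulting surplus.
        have k5 : 0 ≤ (2 * R + R ^ 2 + t) * h * δ ^ 2 := by positivity
        have k6 : 0 ≤ (1 + 2 * s + 2 * m * Λ ^ 2) * h * (h * P) := by positivity
        linarith

end EulerStability

/-! ### Control of the coupled Euler kernels -/

section EulerControl

variable {d : ℕ} {a : C(EuclideanSpace ℝ (Fin d), EuclideanSpace ℝ (Fin d))}
  {b : C(EuclideanSpace ℝ (Fin d), EuclideanSpace ℝ (Fin d) →L[ℝ] EuclideanSpace ℝ (Fin d))}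
  {Λ Γ : ℝ}

lemma lyapunovRate_nonneg {m : ℝ} (hΛ : 0 ≤ Λ) (hΓ : 0 ≤ Γ) (hm : 0 ≤ m) :
    0 ≤ lyapunovRate Λ Γ m := by
  unfold lyapunovRate momentRate; positivity

/-- Iterating `1 + r h` over `2 ^ l` steps of size `h = h_{l+1}` gives at most `exp (r * 2 ^ l * h)
≤ exp r`, uniformly in the level. -/
lemma CoefficientBounds.lintegral_coupledEulerKernel_le (H : CoefficientBounds a b Λ Γ) (l : ℕ)
    (p : EuclideanSpace ℝ (Fin d) × EuclideanSpace ℝ (Fin d)) :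
    ∫⁻ z, ENNReal.ofReal (eulerLyapunov (stepSize (l + 1)) z) ∂(coupledEulerKernel a b (l + 1) p) ≤
      ENNReal.ofReal (Real.exp (lyapunovRate Λ Γ (gaussianMoment d)) *
        eulerLyapunov (stepSize (l + 1)) p) := by
  have hh := stepSize_pos (l + 1)
  have hr := lyapunovRate_nonneg H.lip_nonneg H.growth_nonneg (gaussianMoment_nonneg d)
  set r := lyapunovRate Λ Γ (gaussianMoment d) with hrdef
  rw [coupledEulerKernel, Nat.add_sub_cancel]
  refine (lintegral_kernel_pow_le (measurable_eulerLyapunov _).ennreal_ofReal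
    (H.lintegral_coupledEulerStep_le hh (stepSize_le_one _)) (2 ^ l) p).trans ?_
  rw [← ENNReal.ofReal_pow (by positivity),
    ← ENNReal.ofReal_mul' (eulerLyapunov_nonneg hh.le p)]
  refine ENNReal.ofReal_le_ofReal
    (mul_le_mul_of_nonneg_right ?_ (eulerLyapunov_nonneg hh.le p))
  have h2 : (2 : ℝ) ^ l * stepSize (l + 1) ≤ 1 := by
    rw [stepSize, pow_succ, mul_inv_le_iff₀ (by positivity)]
    have : (0 : ℝ) < 2 ^ l := by positivity
    linarith
  calc (1 + r * stepSize (l + 1)) ^ (2 ^ l)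
      ≤ Real.exp (r * stepSize (l + 1)) ^ (2 ^ l) := by
        refine pow_le_pow_left₀ (by positivity) ?_ _
        rw [add_comm]; exact Real.add_one_le_exp _
    _ = Real.exp (r * (2 ^ l * stepSize (l + 1))) := by
        rw [← Real.exp_nat_mul]; congr 1; push_cast; ring
    _ ≤ Real.exp r := Real.exp_le_exp.2 (mul_le_of_le_one_right hr h2)

/-- Truncated square root of the Lyapunov function. -/
noncomputable def eulerControl (h : ℝ)
    (p : EuclideanSpace ℝ (Fin d) × EuclideanSpace ℝ (Fin d)) : ℝ :=
  min 1 √(eulerLyapunov h p)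

lemma eulerControl_mem_Icc (h : ℝ) (p : EuclideanSpace ℝ (Fin d) × EuclideanSpace ℝ (Fin d)) :
    eulerControl h p ∈ Set.Icc 0 1 :=
  ⟨le_min zero_le_one (Real.sqrt_nonneg _), min_le_left _ _⟩

lemma measurable_eulerControl (h : ℝ) : Measurable (eulerControl (d := d) h) :=
  measurable_const.min (measurable_eulerLyapunov h).sqrt

lemma min_one_dist_le_eulerControl {h : ℝ} (hh : 0 ≤ h) (x x' : EuclideanSpace ℝ (Fin d)) :
    min 1 (dist x x') ≤ eulerControl h (x, x') := by
  refine min_le_min_left _ (Real.le_sqrt_of_sq_le ?_)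
  rw [dist_eq_norm, eulerLyapunov]
  exact le_add_of_nonneg_right (by positivity)

/-- The Lyapunov bound passes to the square root by Jensen's inequality, here nonnegativity of the
variance. The truncation at `1` survives because the constant is at least `1`. -/
lemma CoefficientBounds.integral_eulerControl_le (H : CoefficientBounds a b Λ Γ) (l : ℕ)
    (p : EuclideanSpace ℝ (Fin d) × EuclideanSpace ℝ (Fin d)) :
    ∫ z, eulerControl (stepSize (l + 1)) z ∂(coupledEulerKernel a b (l + 1) p) ≤
      √(Real.exp (lyapunovRate Λ Γ (gaussianMoment d))) * eulerControl (stepSize (l + 1)) p := by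
  have hh := (stepSize_pos (l + 1)).le
  have hr := lyapunovRate_nonneg H.lip_nonneg H.growth_nonneg (gaussianMoment_nonneg d)
  have hf := eulerLyapunov_nonneg hh p
  set h := stepSize (l + 1) with hdef
  set D := Real.exp (lyapunovRate Λ Γ (gaussianMoment d)) with hD
  have hD1 : 1 ≤ √D := Real.one_le_sqrt.2 (Real.one_le_exp hr)
  set μ := coupledEulerKernel a b (l + 1) p with hμ
  have hm := measurable_eulerControl (d := d) h
  have hL : MemLp (eulerControl h) 2 μ := MemLp.of_bound hm.aestronglyMeasurable 1
    (ae_of_all _ fun z => abs_le_of_mem_Icc (eulerControl_mem_Icc h z))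
  have hsq : ∫ z, eulerControl h z ^ 2 ∂μ ≤ D * eulerLyapunov h p := by
    rw [integral_eq_lintegral_of_nonneg_ae (ae_of_all _ fun z => sq_nonneg _)
      (hm.pow_const 2).aestronglyMeasurable]
    refine ENNReal.toReal_le_of_le_ofReal (mul_nonneg (Real.exp_pos _).le hf)
      (le_trans (lintegral_mono fun z => ENNReal.ofReal_le_ofReal ?_)
        (H.lintegral_coupledEulerKernel_le l p))
    rw [← Real.sq_sqrt (eulerLyapunov_nonneg hh z)]
    exact pow_le_pow_left₀ (eulerControl_mem_Icc h z).1 (min_le_right _ _) 2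
  have hvar : (∫ z, eulerControl h z ∂μ) ^ 2 ≤ ∫ z, eulerControl h z ^ 2 ∂μ := by
    have h1 := variance_nonneg (eulerControl h) μ
    rw [variance_eq_sub hL] at h1
    simpa using h1
  have h1 : ∫ z, eulerControl h z ∂μ ≤ √D * √(eulerLyapunov h p) := by
    rw [← Real.sqrt_mul (Real.exp_pos _).le]
    exact Real.le_sqrt_of_sq_le (hvar.trans hsq)
  have h2 : ∫ z, eulerControl h z ∂μ ≤ √D * 1 := by
    rw [mul_one]
    exact (integral_mem_Icc fun z => eulerControl_mem_Icc h z).2.trans hD1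
  unfold eulerControl
  rw [mul_min_of_nonneg _ _ (Real.sqrt_nonneg _)]
  exact le_min h2 h1

theorem CoefficientBounds.isCouplingControl (H : CoefficientBounds a b Λ Γ)
    {g : ℕ → Potential (EuclideanSpace ℝ (Fin d))} {c C : ℝ} (hc : 1 ≤ c) (hC : 0 ≤ C)
    (h₁ : ∀ k x, c⁻¹ ≤ g k x) (h₂ : ∀ k x, g k x ≤ c)
    (h₃ : ∀ k x x', |g k x - g k x'| ≤ C * dist x x') (l : ℕ) :
    IsCouplingControl g (coupledEulerKernel a b (l + 1))
      (√(Real.exp (lyapunovRate Λ Γ (gaussianMoment d))) + (c + C)) c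
      (eulerControl (stepSize (l + 1))) where
  one_le := hc
  nonneg := by positivity
  inv_le := h₁
  le := h₂
  measurable := measurable_eulerControl _
  mem_Icc := eulerControl_mem_Icc _
  abs_sub_le k x x' := by
    have h0 := min_one_dist_le_eulerControl (stepSize_pos (l + 1)).le x x'
    -- Boundedness handles far points and the Lipschitz bound near ones. The constant `A` must also
    -- bound the growth under the kernel, hence it is a sum.
    have h4 : |g k x - g k x'| ≤ (c + C) * min 1 (dist x x') := by
      rw [mul_min_of_nonneg _ _ (by positivity)]
      refine le_min ?_ ((h₃ k x x').trans ?_)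
      · have := (g k).pos x
        have := (g k).pos x'
        rw [abs_le]
        constructor <;> linarith [h₂ k x, h₂ k x']
      · gcongr; linarith
    refine h4.trans (mul_le_mul ?_ h0 (le_min zero_le_one dist_nonneg) (by positivity))
    exact le_add_of_nonneg_left (Real.sqrt_nonneg _)
  integral_le p := by
    refine (H.integral_eulerControl_le l p).trans
      (mul_le_mul_of_nonneg_right ?_ (eulerControl_mem_Icc _ p).1)
    exact le_add_of_nonneg_right (by positivity)

/-- The origin of the rate `h_l^{1/2}`: on the diagonal only `h (1 + |x|²)` remains under the root.
-/
lemma eulerControl_diag_le (l : ℕ) (x : EuclideanSpace ℝ (Fin d)) :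
    eulerControl (stepSize l) (x, x) ≤ √(1 + ‖x‖ ^ 2) * stepSize l ^ (1 / 2 : ℝ) := by
  refine (min_le_right _ _).trans_eq ?_
  rw [← Real.sqrt_eq_rpow, mul_comm, ← Real.sqrt_mul (stepSize_pos l).le]
  simp [eulerLyapunov]

end EulerControl

/-! ### Signs of the constants, and the split into variance and squared bias. -/

lemma filterConst_nonneg {A c : ℝ} (hA : 0 ≤ A) (hc : 0 ≤ c) (n : ℕ) : 0 ≤ filterConst A c n := by
  have hR : 0 ≤ selectionConst A c := by unfold selectionConst; positivity
  refine Finset.sum_nonneg fun k _ => ?_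
  have := backwardConst_nonneg hA hc (n - k)
  positivity

lemma singleConst_nonneg (c : ℝ) (n : ℕ) : 0 ≤ singleConst c n :=
  Finset.sum_nonneg fun _ _ => sq_nonneg _

lemma integral_sq_sub_eq_add {Ω : Type*} [MeasurableSpace Ω] {μ : Measure Ω}
    [IsProbabilityMeasure μ] {X : Ω → ℝ} (hX : MemLp X 2 μ) {q : ℝ} (hq : ∫ ω, X ω ∂μ = q)
    (p : ℝ) : ∫ ω, (X ω - p) ^ 2 ∂μ = ∫ ω, (X ω - q) ^ 2 ∂μ + (q - p) ^ 2 := by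
  have h1 : Integrable (fun ω => (X ω - q) ^ 2) μ := (hX.sub (memLp_const q)).integrable_sq
  have h2 : Integrable (fun ω => X ω - q) μ := (hX.integrable one_le_two).sub (integrable_const q)
  have h3 : Integrable (fun ω => 2 * (q - p) * (X ω - q) + (q - p) ^ 2) μ :=
    (h2.const_mul _).add (integrable_const _)
  have e : ∀ ω, (X ω - p) ^ 2 = (X ω - q) ^ 2 + (2 * (q - p) * (X ω - q) + (q - p) ^ 2) :=
    fun ω => by ring
  simp_rw [e]
  rw [integral_add h1 h3, integral_add (h2.const_mul _) (integrable_const _), integral_const_mul,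
    integral_sub (hX.integrable one_le_two) (integrable_const q), hq]
  simp

end MLPF

/-! ### Assembly of the two parts of the theorem. -/

theorem theorem1 {d m : ℕ}
    (G : EuclideanSpace ℝ (Fin d) → EuclideanSpace ℝ (Fin m) → ℝ)
    (y : ℕ → EuclideanSpace ℝ (Fin m)) (x₀ : EuclideanSpace ℝ (Fin d))
    (hG : PotentialAssumption fun k x => G x (y (k + 1))) :
    -- general approximations: unbiasedness and the mean square error bound
    (∀ (Q : ℕ → Kernel (EuclideanSpace ℝ (Fin d)) (EuclideanSpace ℝ (Fin d)))
        (M : ℕ → Kernel (EuclideanSpace ℝ (Fin d) × EuclideanSpace ℝ (Fin d))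
          (EuclideanSpace ℝ (Fin d) × EuclideanSpace ℝ (Fin d)))
        [∀ l, IsMarkovKernel (Q l)] [∀ l, IsMarkovKernel (M l)],
      IsMultilevelCoupling Q M → KernelAssumption Q →
      ∃ B : ℕ → ℕ → ℝ, ∀ n L : ℕ, 1 ≤ n → 1 ≤ L → ∀ N : ℕ → ℕ+,
        MemLp (multilevelEstimate hG.potential n L N) 2
          (multilevelLaw hG.potential Q M x₀ L N) ∧
        ∫ ω, multilevelEstimate hG.potential n L N ω ∂(multilevelLaw hG.potential Q M x₀ L N)
          = marginalLikelihood (Q L) n hG.potential x₀ ∧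
        ∫ ω, (multilevelEstimate hG.potential n L N ω
            - marginalLikelihood (Q L) n hG.potential x₀) ^ 2
            ∂(multilevelLaw hG.potential Q M x₀ L N)
          ≤ ∑ l ∈ Finset.range (L + 1), B l n / (N l : ℝ)) ∧
    -- the Euler case: rate of the constants, and cost
    (∀ (a : C(EuclideanSpace ℝ (Fin d), EuclideanSpace ℝ (Fin d)))
        (b : C(EuclideanSpace ℝ (Fin d),
          EuclideanSpace ℝ (Fin d) →L[ℝ] EuclideanSpace ℝ (Fin d))),
      DiffusionAssumption a b → KernelAssumption (eulerKernel a b) →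
      IsMultilevelCoupling (eulerKernel a b) (coupledEulerKernel a b) ∧
      ∃ (B : ℕ → ℕ → ℝ) (C : ℕ → ℝ), ∀ n : ℕ, 1 ≤ n →
        (∀ l, B l n ≤ C n * stepSize l ^ (1 / 2 : ℝ)) ∧
        (∀ L : ℕ, 1 ≤ L → ∀ N : ℕ → ℕ+,
          ∫ ω, (multilevelEstimate hG.potential n L N ω
              - marginalLikelihood (eulerKernel a b L) n hG.potential x₀) ^ 2
              ∂(multilevelLaw hG.potential (eulerKernel a b) (coupledEulerKernel a b) x₀ L N)
            ≤ ∑ l ∈ Finset.range (L + 1), B l n / (N l : ℝ)) ∧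
        (∀ ε : ℝ, 0 < ε → ε < 1 →
          multilevelCost (finestLevel ε) (sampleSizes ε) ≤ C n * ε ^ (-(5 / 2) : ℝ) ∧
          ∫ ω, (multilevelEstimate hG.potential n (finestLevel ε) (sampleSizes ε) ω
              - marginalLikelihood (eulerKernel a b (finestLevel ε)) n hG.potential x₀) ^ 2
              ∂(multilevelLaw hG.potential (eulerKernel a b) (coupledEulerKernel a b) x₀
                (finestLevel ε) (sampleSizes ε))
            ≤ C n * ε ^ 2 ∧
          -- for any target `p` that the level-`L` normalizing constant approximates to order `h_L`
          ∀ p K : ℝ,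
            |marginalLikelihood (eulerKernel a b (finestLevel ε)) n hG.potential x₀ - p|
              ≤ K * stepSize (finestLevel ε) →
            ∫ ω, (multilevelEstimate hG.potential n (finestLevel ε) (sampleSizes ε) ω - p) ^ 2
              ∂(multilevelLaw hG.potential (eulerKernel a b) (coupledEulerKernel a b) x₀
                (finestLevel ε) (sampleSizes ε))
            ≤ (C n + K ^ 2) * ε ^ 2)) := by
  obtain ⟨c, hc, C, hC, hg⟩ := hG.exists_bound
  have hlow := fun k => (hg k).1
  have hup := fun k => (hg k).2.1
  have hlip := fun k => (hg k).2.2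
  refine ⟨fun Q M _ _ hM _ => ?_, fun a b hab _ => ⟨isMultilevelCoupling_euler a b, ?_⟩⟩
  -- The filter bounds are stated for `n + 1` observations, hence `n - 1`. Level `0` is an uncoupled
  -- filter; the others use the constant control `Ψ = 1`.
  · refine ⟨fun l n => if l = 0 then singleConst c (n - 1) else filterConst c c (n - 1), ?_⟩
    intro n L hn _ N
    obtain ⟨n, rfl⟩ : ∃ r, n = r + 1 := ⟨n - 1, by omega⟩
    exact multilevelLaw_of_control hM (Ψ := fun _ _ => 1)
      (fun l => isCouplingControl_one hc.le hlow hup (M (l + 1))) x₀ n L N (by simp) (by simp)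
  · obtain ⟨Λ, Γ, H⟩ := hab.exists_coefficientBounds
    have hΨ := H.isCouplingControl hc.le hC.le hlow hup hlip
    set A := √(Real.exp (lyapunovRate Λ Γ (gaussianMoment d))) + (c + C) with hA
    have hF : ∀ n, 0 ≤ filterConst A c n := fun n =>
      filterConst_nonneg (hΨ 0).nonneg (zero_le_one.trans hc.le) n
    let costConst : ℝ := 4 + 2 * 2 / ((2 : ℝ) ^ (1 / 4 : ℝ) - 1) ^ 2
    have hcost : 0 ≤ costConst := by positivity
    -- One constant for all purposes: level `0` (where `h_0 = 1`), the coupled levels, and the cost.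
    let D : ℕ → ℝ := fun n =>
      singleConst c (n - 1) + filterConst A c (n - 1) * √(1 + ‖x₀‖ ^ 2) + costConst
    have hFS : ∀ n, 0 ≤ filterConst A c n * √(1 + ‖x₀‖ ^ 2) := fun n =>
      mul_nonneg (hF n) (Real.sqrt_nonneg _)
    have hD : ∀ n, 0 ≤ D n := fun n =>
      add_nonneg (add_nonneg (singleConst_nonneg _ _) (hFS _)) hcost
    have key : ∀ n L : ℕ, 1 ≤ n → ∀ N : ℕ → ℕ+,
        MemLp (multilevelEstimate hG.potential n L N) 2
          (multilevelLaw hG.potential (eulerKernel a b) (coupledEulerKernel a b) x₀ L N) ∧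
        ∫ ω, multilevelEstimate hG.potential n L N ω
            ∂(multilevelLaw hG.potential (eulerKernel a b) (coupledEulerKernel a b) x₀ L N)
          = marginalLikelihood (eulerKernel a b L) n hG.potential x₀ ∧
        ∫ ω, (multilevelEstimate hG.potential n L N ω
            - marginalLikelihood (eulerKernel a b L) n hG.potential x₀) ^ 2
            ∂(multilevelLaw hG.potential (eulerKernel a b) (coupledEulerKernel a b) x₀ L N)
          ≤ ∑ l ∈ Finset.range (L + 1), D n * stepSize l ^ (1 / 2 : ℝ) / (N l : ℝ) := by
      intro n L hn N
      obtain ⟨n, rfl⟩ : ∃ r, n = r + 1 := ⟨n - 1, by omega⟩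
      refine multilevelLaw_of_control (isMultilevelCoupling_euler a b)
        (Ψ := fun l => eulerControl (stepSize l)) hΨ x₀ n L N
        (B := fun l => D (n + 1) * stepSize l ^ (1 / 2 : ℝ)) ?_ fun l => ?_
      · simp only [D, stepSize, pow_zero, inv_one, Real.one_rpow, mul_one, Nat.add_sub_cancel]
        linarith [hFS n]
      · calc _ ≤ filterConst A c n * (√(1 + ‖x₀‖ ^ 2) * stepSize (l + 1) ^ (1 / 2 : ℝ)) :=
              mul_le_mul_of_nonneg_left (eulerControl_diag_le (l + 1) x₀) (hF n)
          _ = filterConst A c n * √(1 + ‖x₀‖ ^ 2) * stepSize (l + 1) ^ (1 / 2 : ℝ) := by ring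
          _ ≤ _ := by
              refine mul_le_mul_of_nonneg_right ?_ (Real.rpow_nonneg (stepSize_pos _).le _)
              simp only [D, Nat.add_sub_cancel]
              linarith [singleConst_nonneg c n]
    refine ⟨fun l n => D n * stepSize l ^ (1 / 2 : ℝ), D, fun n hn =>
      ⟨fun l => le_rfl, fun L _ N => (key n L hn N).2.2, fun ε hε hε1 => ?_⟩⟩
    obtain ⟨hmem, hmean, hmse⟩ := key n (finestLevel ε) hn (sampleSizes ε)
    have hmse' := calc
      _ ≤ _ := hmse
      _ = D n * ∑ l ∈ Finset.range (finestLevel ε + 1),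
          stepSize l ^ (1 / 2 : ℝ) / (sampleSizes ε l : ℝ) := by
        rw [Finset.mul_sum]
        exact Finset.sum_congr rfl fun l _ => mul_div_assoc _ _ _
      _ ≤ D n * ε ^ 2 :=
        mul_le_mul_of_nonneg_left (sum_sqrt_stepSize_div_sampleSizes_le hε) (hD n)
    refine ⟨(multilevelCost_le hε hε1).trans
      (mul_le_mul_of_nonneg_right ?_ (Real.rpow_nonneg hε.le _)), hmse', fun p K hp => ?_⟩
    · exact le_add_of_nonneg_left (add_nonneg (singleConst_nonneg _ _) (hFS _))
    -- By unbiasedness for level `L` the error splits exactly; the squared bias is at most `K² h_L²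
    -- ≤ K² ε²`.
    · rw [integral_sq_sub_eq_add hmem hmean, add_mul]
      refine add_le_add hmse' ?_
      calc _ ≤ (K * stepSize (finestLevel ε)) ^ 2 := sq_le_sq' (abs_le.1 hp).1 (abs_le.1 hp).2
        _ = K ^ 2 * stepSize (finestLevel ε) ^ 2 := mul_pow _ _ _
        _ ≤ _ := mul_le_mul_of_nonneg_left (pow_le_pow_left₀ (stepSize_pos _).le
            (stepSize_finestLevel_le hε) 2) (sq_nonneg _)
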